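/- Let $C=(c_{ij})_{i,j\in I}$ be an irreducible symmetrizable generalized Cartan matrix ($I$ finite) with a (not necessarily minimal) symmetrizer $D=\mathrm{diag}(d_i)$, $d_i\in\mathbb Z_{>0}$, so that $DC$ is symmetric. Write $i\sim j$ if $c_{ij}<0$, and for $i\sim j$ put $g_{ij}=\gcd(|c_{ij}|,|c_{ji}|)$, $f_{ij}=|c_{ij}|/g_{ij}$; put $r=\mathrm{lcm}(d_i\mid i\in I)$ and $[k]_x=(x^k-x^{-k})/(x-x^{-1})$. Let $\Gamma$ be the multiplicative abelian group generated by $q$, $t$ and $\mu_{ij}^{(g)}$ ($i\sim j$, $1\le g\le g_{ij}$) subject to $\mu_{ij}^{(g)}\mu_{ji}^{(g)}=1$, let $\mathbb Q(\Gamma)$ be the fraction field of $\mathbb Z[\Gamma]$, and let $\phi$ be its automorphism fixing $q,t$ and sending $\mu_{ij}^{(g)}$ to $\mu_{ji}^{(g)}$. Define $$C_{ii}(q,t,\underline\mu)=q^{d_i}t^{-1}+q^{-d_i}t,\qquad C_{ij}(q,t,\underline\mu)=-[f_{ij}]_{q^{d_i}}\sum_{g=1}^{g_{ij}}\mu_{ij}^{(g)}\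 (i\sim j),$$ and $C_{ij}(q,t,\underline\mu)=0$ otherwise. Let $\mathsf Q_\Gamma=\bigoplus_{i\in I}\mathbb Q(\Gamma)\alpha_i$ with the form $(-,-)_\Gamma$ that is $\phi$-semilinear in the first and linear in the second variable and satisfies $(\alpha_i,\alpha_j)_\Gamma=[d_i]_qC_{ij}(q,t,\underline\mu)$. Put $\alpha_i^\vee=q^{-d_i}t[d_i]_q^{-1}\alpha_i$ and $T_ix=x-(\alpha_i^\vee,x)_\Gamma\,\alpha_i$. Let $W$ be the Weyl group, generated by the simple reflections $s_i\alpha_j=\alpha_j-c_{ij}\alpha_i$ of $\bigoplus_{i\in I}\mathbb Z\alpha_i$, and for $w\in W$ put $T_w=T_{i_1}\cdots T_{i_l}$, where $w=s_{i_1}\cdots s_{i_l}$ is a reduced expression. Assume that $C$ is of finite type, that is, $DC$ is positive definite. Let $w_0\in W$ be the longest element and define $i\mapsto i^*$ by $w_0\alpha_i=-\alpha_{i^*}$. For $i,j\in I$ put $\mu_{ij}=\mu_{i i_1}^{(1)}\mu_{i_1i_2}^{(1)}\cdots\mu_{i_kj}^{(1)}$ for any sequence $i\sim i_1\sim\cdots\sim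 i_k\sim j$ (the empty product if $i=j$ and the sequence is trivial), and let $\nu$ be the $\mathbb Q(\Gamma)$-linear map with $\nu(\alpha_i)=\mu_{i^*i}\alpha_{i^*}$. Let $h=1+\mathrm{ht}(\theta)$ and $h^\vee=1+\mathrm{ht}(\theta^\vee)$ be the Coxeter and dual Coxeter numbers of $C$, where $\theta$ is the highest root, $\theta^\vee$ its coroot, and the heights are taken with respect to the simple roots and the simple coroots. Then, for every choice of the reduced expression of $w_0$, $$T_{w_0}=-q^{-rh^\vee}t^h\,\nu .$$ -/

import Mathlib

/-- A symmetrizable generalized Cartan matrix `C = (c i j)` together with a (not necessarily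
minimal) symmetrizer `D = diag (d i)`. Irreducibility is the separate predicate
`SymGCM.Irreducible`. -/
structure SymGCM (I : Type*) where
  c : I → I → ℤ
  d : I → ℕ
  c_self : ∀ i, c i i = 2
  c_nonpos : ∀ i j, i ≠ j → c i j ≤ 0
  c_zero_iff : ∀ i j, c i j = 0 ↔ c j i = 0
  d_pos : ∀ i, 0 < d i
  symm : ∀ i j, (d i : ℤ) * c i j = (d j : ℤ) * c j i

namespace SymGCM

theorem c_neg_symm {I : Type*} (C : SymGCM I) {i j : I} (h : C.c i j < 0) : C.c j i < 0 := by
  have hij : i ≠ j := by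
    rintro rfl
    rw [C.c_self] at h
    omega
  have h1 := C.c_nonpos j i hij.symm
  have h2 : C.c j i ≠ 0 := fun h0 => by
    rw [(C.c_zero_iff j i).1 h0] at h
    omega
  omega

/-- The graph on `I` with `i ∼ j` if and only if `c i j < 0`. -/
def graph {I : Type*} (C : SymGCM I) : SimpleGraph I where
  Adj i j := C.c i j < 0
  symm := ⟨fun _ _ h => C.c_neg_symm h⟩
  loopless := ⟨fun i h => by
    rw [C.c_self] at h
    omega⟩

/-- Any two indices are joined by a sequence `i ∼ i₁ ∼ ⋯ ∼ j`. -/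
def Irreducible {I : Type*} (C : SymGCM I) : Prop := C.graph.Preconnected

/-- `C` is of finite type if it is positive definite, that is, if its symmetrization `D C` is. -/
def IsFiniteType {I : Type*} (C : SymGCM I) : Prop :=
  (Matrix.of fun i j => (((C.d i : ℤ) * C.c i j : ℤ) : ℝ)).PosDef

/-- `g i j = gcd (|c i j|, |c j i|)`. -/
def g {I : Type*} (C : SymGCM I) (i j : I) : ℕ := Int.gcd (C.c i j) (C.c j i)

/-- `f i j = |c i j| / g i j` (an exact division). -/
def f {I : Type*} (C : SymGCM I) (i j : I) : ℕ := (C.c i j).natAbs / C.g i j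

/-- `r = lcm (d i | i ∈ I)`. -/
def r {I : Type*} [Fintype I] (C : SymGCM I) : ℕ := Finset.univ.lcm C.d

theorem g_comm {I : Type*} (C : SymGCM I) (i j : I) : C.g i j = C.g j i := Int.gcd_comm _ _

/-! ### The group `Γ`, its group ring and the fraction field -/

/-- The generators `q`, `t` and `μ_{ij}^{(a)}` (`c i j < 0`, `1 ≤ a ≤ g i j`) of `Γ`. -/
inductive Gen {I : Type*} (C : SymGCM I)
  | q : Gen C
  | t : Gen C
  | mu (i j : I) (a : ℕ) (hij : C.c i j < 0) (h1 : 1 ≤ a) (ha : a ≤ C.g i j) : Gen C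

/-- `q ↦ q`, `t ↦ t`, `μ_{ij}^{(a)} ↦ μ_{ji}^{(a)}` on generators. -/
def Gen.swap {I : Type*} {C : SymGCM I} : Gen C → Gen C
  | .q => .q
  | .t => .t
  | .mu i j a hij h1 ha => .mu j i a (C.c_neg_symm hij) h1 (C.g_comm i j ▸ ha)

theorem Gen.swap_swap {I : Type*} {C : SymGCM I} (x : Gen C) : x.swap.swap = x := by
  cases x <;> rfl

/-- `Gen.swap` extended to the free abelian group (written additively). -/
noncomputable def freeSwap {I : Type*} (C : SymGCM I) : (Gen C →₀ ℤ) →+ (Gen C →₀ ℤ) :=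
  Finsupp.mapDomain.addMonoidHom Gen.swap

/-- The relations `μ_{ij}^{(a)} μ_{ji}^{(a)} = 1`, written additively. -/
def relSet {I : Type*} (C : SymGCM I) : Set (Gen C →₀ ℤ) :=
  {x | ∃ (i j : I) (a : ℕ) (hij : C.c i j < 0) (h1 : 1 ≤ a) (ha : a ≤ C.g i j),
    x = Finsupp.single (Gen.mu i j a hij h1 ha) 1
      + Finsupp.single (Gen.mu i j a hij h1 ha).swap 1}

/-- The subgroup generated by the relations. -/
noncomputable def relSubgroup {I : Type*} (C : SymGCM I) : AddSubgroup (Gen C →₀ ℤ) :=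
  AddSubgroup.closure C.relSet

/-- The abelian group `Γ` generated by `q`, `t`, `μ_{ij}^{(a)}` with the relations
`μ_{ij}^{(a)} μ_{ji}^{(a)} = 1`, written multiplicatively. -/
abbrev Gam {I : Type*} (C : SymGCM I) : Type _ :=
  Multiplicative ((Gen C →₀ ℤ) ⧸ C.relSubgroup)

/-- The image in `Γ` of a generator. -/
noncomputable def ofGen {I : Type*} (C : SymGCM I) (x : Gen C) : C.Gam :=
  Multiplicative.ofAdd (QuotientAddGroup.mk (Finsupp.single x 1))

theorem freeSwap_mem {I : Type*} (C : SymGCM I) :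
    C.relSubgroup ≤ C.relSubgroup.comap C.freeSwap := by
  rw [relSubgroup, AddSubgroup.closure_le]
  rintro x ⟨i, j, a, hij, h1, ha, rfl⟩
  apply AddSubgroup.subset_closure
  refine ⟨j, i, a, C.c_neg_symm hij, h1, C.g_comm i j ▸ ha, ?_⟩
  simp [freeSwap, Finsupp.mapDomain_add, Finsupp.mapDomain_single, Gen.swap]

/-- The endomorphism `φ` of `Γ` induced by `Gen.swap`. -/
noncomputable def phiHom {I : Type*} (C : SymGCM I) :
    ((Gen C →₀ ℤ) ⧸ C.relSubgroup) →+ ((Gen C →₀ ℤ) ⧸ C.relSubgroup) :=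
  QuotientAddGroup.map _ _ C.freeSwap C.freeSwap_mem

theorem phiHom_phiHom {I : Type*} (C : SymGCM I) (x : (Gen C →₀ ℤ) ⧸ C.relSubgroup) :
    C.phiHom (C.phiHom x) = x := by
  obtain ⟨y, rfl⟩ := QuotientAddGroup.mk_surjective x
  simp only [phiHom, QuotientAddGroup.map_mk]
  congr 1
  simp only [freeSwap, Finsupp.mapDomain.addMonoidHom_apply, ← Finsupp.mapDomain_comp]
  have : (Gen.swap ∘ Gen.swap : Gen C → Gen C) = id := funext Gen.swap_swap
  rw [this, Finsupp.mapDomain_id]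

/-- The automorphism `φ` of `Γ`: `φ q = q`, `φ t = t`, `φ μ_{ij}^{(a)} = μ_{ji}^{(a)}`. -/
noncomputable def phiGam {I : Type*} (C : SymGCM I) : C.Gam ≃* C.Gam :=
  AddEquiv.toMultiplicative
    { toFun := C.phiHom
      invFun := C.phiHom
      left_inv := C.phiHom_phiHom
      right_inv := C.phiHom_phiHom
      map_add' := map_add _ }

/-- `Γ` embeds in a free abelian group, so `ℤ[Γ]` has no zero divisors. -/
theorem exists_injective_hom {I : Type*} (C : SymGCM I) :
    ∃ F : ((Gen C →₀ ℤ) ⧸ C.relSubgroup) →+ (Gen C →₀ ℤ), Function.Injective F := by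
  classical
  let lt : I → I → Prop := WellOrderingRel
  let v : Gen C → (Gen C →₀ ℤ)
    | .q => Finsupp.single .q 1
    | .t => Finsupp.single .t 1
    | .mu i j a hij h1 ha =>
      if lt i j then Finsupp.single (.mu i j a hij h1 ha) 1
      else -Finsupp.single (Gen.mu i j a hij h1 ha).swap 1
  let P : (Gen C →₀ ℤ) →+ (Gen C →₀ ℤ) :=
    Finsupp.liftAddHom fun x => (zmultiplesHom _ (v x))
  have hP : ∀ x, P (Finsupp.single x 1) = v x := fun x => by simp [P]
  have hker : C.relSubgroup ≤ P.ker := by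
    rw [relSubgroup, AddSubgroup.closure_le]
    rintro x ⟨i, j, a, hij, h1, ha, rfl⟩
    have hne : i ≠ j := by
      rintro rfl
      rw [C.c_self] at hij
      omega
    have key : v (.mu i j a hij h1 ha) + v (Gen.mu i j a hij h1 ha).swap = 0 := by
      rcases trichotomous_of (WellOrderingRel (α := I)) i j with h | h | h
      · have h' : ¬ lt j i := asymm_of WellOrderingRel h
        have h2 : lt i j := h
        simp [v, Gen.swap, h', h2]
      · exact absurd h hne
      · have h' : ¬ lt i j := asymm_of WellOrderingRel h
        have h2 : lt j i := h
        simp [v, Gen.swap, h', h2]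
    simp only [SetLike.mem_coe, AddMonoidHom.mem_ker, map_add, hP]
    exact key
  have hcong : ∀ x, x - P x ∈ C.relSubgroup := by
    intro x
    induction x using Finsupp.induction_linear with
    | zero => simp
    | add x y hx hy =>
      have : x + y - P (x + y) = (x - P x) + (y - P y) := by
        rw [map_add]
        abel
      rw [this]
      exact add_mem hx hy
    | single x n =>
      have : (Finsupp.single x n : Gen C →₀ ℤ) = n • Finsupp.single x 1 := by simp
      rw [this, map_zsmul, ← smul_sub, hP]
      apply zsmul_mem
      cases x with
      | q => simp [v]
      | t => simp [v]
      | mu i j a hij h1 ha =>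
        by_cases h : lt i j
        · simp [v, h]
        · simp only [v, h, if_false, sub_neg_eq_add]
          exact AddSubgroup.subset_closure ⟨i, j, a, hij, h1, ha, rfl⟩
  refine ⟨QuotientAddGroup.lift _ P hker, ?_⟩
  rw [injective_iff_map_eq_zero]
  intro y hy
  obtain ⟨x, rfl⟩ := QuotientAddGroup.mk_surjective y
  have hx : P x = 0 := hy
  have := hcong x
  rw [hx, sub_zero] at this
  exact (QuotientAddGroup.eq_zero_iff x).2 this

instance {I : Type*} (C : SymGCM I) : UniqueProds C.Gam := by
  obtain ⟨F, hF⟩ := C.exists_injective_hom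
  exact UniqueProds.of_injective_mulHom
    (AddMonoidHom.toMultiplicative F : C.Gam →ₙ* Multiplicative (Gen C →₀ ℤ))
    hF inferInstance

/-- The fraction field `ℚ(Γ)` of the group ring `ℤ[Γ]`. -/
abbrev K {I : Type*} (C : SymGCM I) : Type _ := FractionRing (MonoidAlgebra ℤ C.Gam)

/-- The inclusion of `Γ` in `ℚ(Γ)`. -/
noncomputable def gamK {I : Type*} (C : SymGCM I) (x : C.Gam) : C.K :=
  algebraMap (MonoidAlgebra ℤ C.Gam) C.K (MonoidAlgebra.of ℤ C.Gam x)

/-- The parameter `q ∈ ℚ(Γ)`. -/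
noncomputable def q {I : Type*} (C : SymGCM I) : C.K := C.gamK (C.ofGen .q)

/-- The parameter `t ∈ ℚ(Γ)`. -/
noncomputable def t {I : Type*} (C : SymGCM I) : C.K := C.gamK (C.ofGen .t)

/-- The parameter `μ_{ij}^{(a)} ∈ Γ`, where `c i j < 0` and `1 ≤ a ≤ g i j` (and `1` for indices
where there is no such parameter; this value is never used). -/
noncomputable def muGam {I : Type*} (C : SymGCM I) (i j : I) (a : ℕ) : C.Gam :=
  open Classical in
  if h : C.c i j < 0 ∧ 1 ≤ a ∧ a ≤ C.g i j then C.ofGen (.mu i j a h.1 h.2.1 h.2.2) else 1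

/-- The automorphism `φ` of `ℚ(Γ)`. -/
noncomputable def phi {I : Type*} (C : SymGCM I) : C.K ≃+* C.K :=
  IsFractionRing.ringEquivOfRingEquiv (MonoidAlgebra.mapDomainRingEquiv ℤ C.phiGam)

/-- The quantum integer `[k]_x = (x ^ k - x ^ (-k)) / (x - x ^ (-1))`. -/
noncomputable def qInt {F : Type*} [Field F] (k : ℕ) (x : F) : F :=
  (x ^ k - (x ^ k)⁻¹) / (x - x⁻¹)

/-! ### The deformed Cartan matrix and the operators `T i` -/

/-- The entries `C_{ij}(q, t, μ)` of the deformed generalized Cartan matrix. -/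
noncomputable def defC {I : Type*} [DecidableEq I] (C : SymGCM I) (i j : I) : C.K :=
  if i = j then C.q ^ C.d i * C.t⁻¹ + (C.q ^ C.d i)⁻¹ * C.t
  else if C.c i j < 0 then
    -(qInt (C.f i j) (C.q ^ C.d i) * ∑ a ∈ Finset.Icc 1 (C.g i j), C.gamK (C.muGam i j a))
  else 0

/-- The simple root `α i` as a basis vector of `Q_Γ = ⊕ ℚ(Γ) α i`, realized as `I → ℚ(Γ)`. -/
noncomputable def alpha {I : Type*} [DecidableEq I] (C : SymGCM I) (i : I) : I → C.K :=
  Pi.single i 1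

/-- The `φ`-sesquilinear form `(x, y)_Γ` on `Q_Γ` with `(α i, α j)_Γ = [d i]_q C_{ij}(q, t, μ)`. -/
noncomputable def form {I : Type*} [Fintype I] [DecidableEq I] (C : SymGCM I)
    (x y : I → C.K) : C.K :=
  ∑ i, ∑ j, C.phi (x i) * y j * (qInt (C.d i) C.q * C.defC i j)

/-- The deformed simple coroot `αᵢ^∨ = q ^ (-d i) t [d i]_q⁻¹ α i`. -/
noncomputable def alphaCheck {I : Type*} [DecidableEq I] (C : SymGCM I) (i : I) : I → C.K :=
  ((C.q ^ C.d i)⁻¹ * C.t * (qInt (C.d i) C.q)⁻¹) • C.alpha i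

/-- The operator `T i x = x - (αᵢ^∨, x)_Γ α i` on `Q_Γ`. -/
noncomputable def T {I : Type*} [Fintype I] [DecidableEq I] (C : SymGCM I) (i : I) :
    Module.End C.K (I → C.K) where
  toFun x := x - C.form (C.alphaCheck i) x • C.alpha i
  map_add' x y := by
    have : C.form (C.alphaCheck i) (x + y)
        = C.form (C.alphaCheck i) x + C.form (C.alphaCheck i) y := by
      simp only [form, Pi.add_apply, mul_add, add_mul, Finset.sum_add_distrib]
    rw [this, add_smul]
    abel
  map_smul' a x := by
    have : C.form (C.alphaCheck i) (a • x) = a * C.form (C.alphaCheck i) x := by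
      simp only [form, Pi.smul_apply, smul_eq_mul, Finset.mul_sum]
      refine Finset.sum_congr rfl fun k _ => Finset.sum_congr rfl fun l _ => ?_
      ring
    rw [this, mul_smul, smul_sub, RingHom.id_apply]

/-- `T_{i₁} T_{i₂} ⋯ T_{i_l}` for a word `(i₁, …, i_l)`. -/
noncomputable def Tword {I : Type*} [Fintype I] [DecidableEq I] (C : SymGCM I) (ω : List I) :
    Module.End C.K (I → C.K) :=
  (ω.map C.T).prod

/-! ### The root lattice and the Weyl group -/

/-- The simple root `α i` in the root lattice `Q = ⊕ ℤ α i`, realized as `I → ℤ`; the same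
vectors serve as the simple coroots in the coroot lattice. -/
def simpleRoot {I : Type*} [DecidableEq I] (_C : SymGCM I) (i : I) : I → ℤ := Pi.single i 1

/-- `s i` on the root lattice, `s i (α j) = α j - c i j • α i`. -/
def reflFun {I : Type*} [Fintype I] [DecidableEq I] (C : SymGCM I) (i : I) (x : I → ℤ) :
    I → ℤ :=
  x - (∑ j, C.c i j * x j) • C.simpleRoot i

/-- `s i` on the coroot lattice, `s i (α j^∨) = α j^∨ - c j i • α i^∨`. -/
def corootReflFun {I : Type*} [Fintype I] [DecidableEq I] (C : SymGCM I) (i : I) (x : I → ℤ) :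
    I → ℤ :=
  x - (∑ j, C.c j i * x j) • C.simpleRoot i

theorem reflFun_reflFun {I : Type*} [Fintype I] [DecidableEq I] (C : SymGCM I) (i : I)
    (x : I → ℤ) : C.reflFun i (C.reflFun i x) = x := by
  have h : ∑ j, C.c i j * (C.reflFun i x) j = -∑ j, C.c i j * x j := by
    simp only [reflFun, simpleRoot, Pi.sub_apply, Pi.smul_apply, smul_eq_mul, mul_sub,
      Finset.sum_sub_distrib, Pi.single_apply, mul_ite, mul_one, mul_zero,
      Finset.sum_ite_eq', Finset.mem_univ, if_true, C.c_self]
    ring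
  rw [reflFun, h, reflFun]
  simp

/-- The simple reflection `s i` as an automorphism of the root lattice. -/
def s {I : Type*} [Fintype I] [DecidableEq I] (C : SymGCM I) (i : I) :
    (I → ℤ) ≃ₗ[ℤ] (I → ℤ) where
  toFun := C.reflFun i
  invFun := C.reflFun i
  left_inv := C.reflFun_reflFun i
  right_inv := C.reflFun_reflFun i
  map_add' x y := by
    simp only [reflFun, Pi.add_apply, mul_add, Finset.sum_add_distrib, add_smul]
    abel
  map_smul' a x := by
    have : ∑ j, C.c i j * (a • x) j = a * ∑ j, C.c i j * x j := by
      simp only [Pi.smul_apply, smul_eq_mul, Finset.mul_sum]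
      exact Finset.sum_congr rfl fun k _ => by ring
    simp only [reflFun, this, mul_smul, smul_sub, RingHom.id_apply]

/-- The Weyl group `W`, the subgroup of `Aut Q` generated by the simple reflections. -/
def weylGroup {I : Type*} [Fintype I] [DecidableEq I] (C : SymGCM I) :
    Subgroup ((I → ℤ) ≃ₗ[ℤ] (I → ℤ)) :=
  Subgroup.closure (Set.range C.s)

/-- `s_{i₁} s_{i₂} ⋯ s_{i_l}` for a word `(i₁, …, i_l)`. -/
def sword {I : Type*} [Fintype I] [DecidableEq I] (C : SymGCM I) (ω : List I) :
    (I → ℤ) ≃ₗ[ℤ] (I → ℤ) :=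
  (ω.map C.s).prod

theorem exists_word {I : Type*} [Fintype I] [DecidableEq I] (C : SymGCM I)
    (w : C.weylGroup) : ∃ ω : List I, C.sword ω = w := by
  have hs : ∀ i, (C.s i)⁻¹ = C.s i := fun i =>
    inv_eq_of_mul_eq_one_left (LinearEquiv.ext fun x => C.reflFun_reflFun i x)
  obtain ⟨w, hw⟩ := w
  induction hw using Subgroup.closure_induction with
  | mem x hx =>
    obtain ⟨i, rfl⟩ := hx
    exact ⟨[i], by simp [sword]⟩
  | one => exact ⟨[], by simp [sword]⟩
  | mul x y _ _ hx hy =>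
    obtain ⟨a, ha⟩ := hx
    obtain ⟨b, hb⟩ := hy
    refine ⟨a ++ b, ?_⟩
    simp only [sword] at ha hb
    simp [sword, ha, hb]
  | inv x _ hx =>
    obtain ⟨a, ha⟩ := hx
    refine ⟨a.reverse, ?_⟩
    simp only [sword] at ha
    simp only [sword, List.map_reverse, ← ha, List.prod_inv_reverse, List.map_map]
    exact congrArg (fun l : List _ => l.reverse.prod) (List.map_congr_left fun i _ => (hs i).symm)

/-- The length of a Weyl group element: the least length of a word representing it. -/
noncomputable def len {I : Type*} [Fintype I] [DecidableEq I] (C : SymGCM I)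
    (w : C.weylGroup) : ℕ :=
  sInf {n | ∃ ω : List I, C.sword ω = w ∧ ω.length = n}

/-- `w = s_{i₁} ⋯ s_{i_l}` is a reduced expression. -/
def IsReducedWord {I : Type*} [Fintype I] [DecidableEq I] (C : SymGCM I)
    (ω : List I) (w : C.weylGroup) : Prop :=
  C.sword ω = w ∧ ω.length = C.len w

theorem exists_reducedWord {I : Type*} [Fintype I] [DecidableEq I] (C : SymGCM I)
    (w : C.weylGroup) : ∃ ω : List I, C.IsReducedWord ω w := by
  obtain ⟨ω, hω⟩ := C.exists_word w
  exact Nat.sInf_mem (s := {n | ∃ ω : List I, C.sword ω = w ∧ ω.length = n}) ⟨_, ω, hω, rfl⟩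

/-- `T_w = T_{i₁} ⋯ T_{i_l}` for a chosen reduced expression `w = s_{i₁} ⋯ s_{i_l}`. -/
noncomputable def Tw {I : Type*} [Fintype I] [DecidableEq I] (C : SymGCM I)
    (w : C.weylGroup) : Module.End C.K (I → C.K) :=
  C.Tword (C.exists_reducedWord w).choose

/-- The longest element `w₀` of the Weyl group. -/
noncomputable def w₀ {I : Type*} [Fintype I] [DecidableEq I] (C : SymGCM I) : C.weylGroup :=
  Classical.epsilon fun w => ∀ w' : C.weylGroup, C.len w' ≤ C.len w

/-- The index `i^*` with `w₀ (α i) = - α (i^*)`. -/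
noncomputable def star {I : Type*} [Fintype I] [DecidableEq I] (C : SymGCM I) (i : I) : I :=
  haveI : Nonempty I := ⟨i⟩
  Classical.epsilon fun k =>
    (C.w₀ : (I → ℤ) ≃ₗ[ℤ] (I → ℤ)) (C.simpleRoot i) = -C.simpleRoot k

/-! ### Roots, coroots, and the Coxeter numbers -/

/-- `IsRootPair β γ`: for some `w ∈ W` and `i ∈ I`, `β = w (α i)` is a (real) root and
`γ = w (α i^∨)` is its coroot. -/
inductive IsRootPair {I : Type*} [Fintype I] [DecidableEq I] (C : SymGCM I) :
    (I → ℤ) → (I → ℤ) → Prop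
  | simple (i : I) : IsRootPair C (C.simpleRoot i) (C.simpleRoot i)
  | refl (i : I) (β γ : I → ℤ) (h : IsRootPair C β γ) :
      IsRootPair C (C.reflFun i β) (C.corootReflFun i γ)

/-- The pair `(θ, θ^∨)` of the highest root (the root all of whose coefficients dominate those of
every other root) and its coroot. -/
noncomputable def highestRootPair {I : Type*} [Fintype I] [DecidableEq I] (C : SymGCM I) :
    (I → ℤ) × (I → ℤ) :=
  Classical.epsilon fun p => C.IsRootPair p.1 p.2 ∧ ∀ β γ, C.IsRootPair β γ → β ≤ p.1

/-- The Coxeter number: one plus the height of the highest root `θ`. -/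
noncomputable def coxeterNumber {I : Type*} [Fintype I] [DecidableEq I] (C : SymGCM I) : ℤ :=
  1 + ∑ i, C.highestRootPair.1 i

/-- The dual Coxeter number: one plus the height `⟨ρ, θ^∨⟩` of the coroot `θ^∨` of the highest
root. -/
noncomputable def dualCoxeterNumber {I : Type*} [Fintype I] [DecidableEq I] (C : SymGCM I) : ℤ :=
  1 + ∑ i, C.highestRootPair.2 i

/-! ### The twisted involution `ν` -/

/-- The product `μ_{i i₁} μ_{i₁ i₂} ⋯ μ_{i_k j}` along a walk in the graph, where
`μ_{ij} = μ_{ij}^{(1)}`. -/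
noncomputable def walkMu {I : Type*} (C : SymGCM I) : {i j : I} → C.graph.Walk i j → C.Gam
  | _, _, .nil => 1
  | i, _, .cons (v := k) _ p => C.muGam i k 1 * walkMu C p

/-- `μ_{ij}` for arbitrary `i, j`: the product along any walk from `i` to `j`. -/
noncomputable def muPath {I : Type*} (C : SymGCM I) (i j : I) : C.Gam :=
  open Classical in
  if h : Nonempty (C.graph.Walk i j) then C.walkMu h.some else 1

/-- The linear map `ν` with `ν (α i) = μ_{i^* i} α (i^*)`. -/
noncomputable def nu {I : Type*} [Fintype I] [DecidableEq I] (C : SymGCM I) :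
    Module.End C.K (I → C.K) :=
  (Pi.basisFun C.K I).constr C.K fun i =>
    C.gamK (C.muPath (C.star i) i) • C.alpha (C.star i)

end SymGCM

/-!
*`T_{w₀}` is a multiple of `ν`.* The `T i` satisfy the braid relations
(`IsFiniteType.T_braid`), so by Matsumoto's theorem (`prod_eq_of_reduced`) the product along a
reduced word of `w₀` does not depend on the word. Comparing the reduced words of
`w₀ = s_{i^*} (s_{i^*} w₀) = (w₀ s_i) s_i` gives
`T_{i^*} T_{w₀} = T_{w₀} T_i` (`IsFiniteType.intertwine`). As `α i` spans the eigenspace of `T i`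
for the eigenvalue `- t² q ^ (- 2 d i) ≠ 1`, the operator `T_{w₀}` maps `α i` to a multiple of
`α (i^*)`; comparing off-diagonal entries for `i ∼ j` shows that the multiples are those of
`κ ν` for a single scalar `κ` (`IsFiniteType.exists_Tword_eq_smul_nu`). Here the products of the
`μ_{ij}` along walks are path independent because the graph is a forest
(`IsFiniteType.isAcyclic`).

*The scalar.* Since `ν² = 1` and `det T i = - t² q ^ (- 2 d i)`, the power `κ ^ (2 n)`, with `n` the
rank, is a monomial in `q` and `t` determined by the length of `w₀` and by the sum of the `d i`
over a reduced word. As the letters of a reduced word of `w₀` correspond to the positive roots `β`,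
these numbers are `∑ 1` and `∑ (β, β) / 2` over `β > 0`. They are computed without classification:
the endomorphism `x ↦ ∑ g(β) ⟨x, β^∨⟩ β` commutes with `W`, hence is a scalar, and its trace is
`2 ∑ g(β)`; evaluating it at the highest root `θ`, for which `⟨β, θ^∨⟩ ∈ {0, 1}` when
`0 < β ≠ θ`, identifies the scalar as `h` for `g = 1` and as `2 r h^∨` for `g(β) = (β, β)`
(`IsFiniteType.sum_reducedWord_w₀`). Hence `κ` agrees with `- q ^ (- r h^∨) t ^ h` up to a root of
unity in `ℤ[Γ]`. At `q = t = μ = 1` the `T i` become the simple reflections, so that this root of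
unity specializes to `1`, and it is therefore equal to `1`
(`Specializes.eq_one_of_pow_eq_one`).

*Roots.* The theory of the Weyl group rests on the fact that every root is positive or negative
(`IsRootPair.nonneg_or_nonpos`), which in finite type follows from a comparison of lengths.
-/

namespace SymGCM

open Finset

set_option linter.unusedSectionVars false

/-! ### The pairing, the invariant form and the sign of a root -/

section Forms

variable {I : Type*} [Fintype I] [DecidableEq I] (C : SymGCM I)

/-- The pairing `⟨x, γ⟩` of the root lattice with the coroot lattice, normalized by
`⟨α j, α i ^∨⟩ = c i j`. -/
def pairing : (I → ℤ) →ₗ[ℤ] (I → ℤ) →ₗ[ℤ] ℤ :=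
  LinearMap.mk₂ ℤ (fun x γ => ∑ i, ∑ j, γ i * (C.c i j * x j))
    (fun x y γ => by simp only [Pi.add_apply, mul_add, sum_add_distrib])
    (fun a x γ => by
      simp only [Pi.smul_apply, smul_eq_mul, mul_sum]
      exact sum_congr rfl fun i _ => sum_congr rfl fun j _ => by ring)
    (fun x γ δ => by simp only [Pi.add_apply, add_mul, sum_add_distrib])
    (fun a x γ => by
      simp only [Pi.smul_apply, smul_eq_mul, mul_sum]
      exact sum_congr rfl fun i _ => sum_congr rfl fun j _ => by ring)

/-- The symmetric form `(x, y)` on the root lattice with `(α i, α j) = d i * c i j`. -/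
def sform : (I → ℤ) →ₗ[ℤ] (I → ℤ) →ₗ[ℤ] ℤ :=
  LinearMap.mk₂ ℤ (fun x y => ∑ i, ∑ j, x i * (C.d i * C.c i j) * y j)
    (fun x y γ => by simp only [Pi.add_apply, add_mul, sum_add_distrib])
    (fun a x γ => by
      simp only [Pi.smul_apply, smul_eq_mul, mul_sum]
      exact sum_congr rfl fun i _ => sum_congr rfl fun j _ => by ring)
    (fun x γ δ => by simp only [Pi.add_apply, mul_add, sum_add_distrib])
    (fun a x γ => by
      simp only [Pi.smul_apply, smul_eq_mul, mul_sum]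
      exact sum_congr rfl fun i _ => sum_congr rfl fun j _ => by ring)

theorem pairing_apply (x γ : I → ℤ) :
    C.pairing x γ = ∑ i, ∑ j, γ i * (C.c i j * x j) := rfl

theorem sform_apply (x y : I → ℤ) :
    C.sform x y = ∑ i, ∑ j, x i * (C.d i * C.c i j) * y j := rfl

theorem sform_comm (x y : I → ℤ) : C.sform x y = C.sform y x := by
  rw [sform_apply, sform_apply, sum_comm]
  refine sum_congr rfl fun i _ => sum_congr rfl fun j _ => ?_
  rw [C.symm j i]
  ring

theorem pairing_simpleRoot_right (x : I → ℤ) (i : I) :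
    C.pairing x (C.simpleRoot i) = ∑ j, C.c i j * x j := by
  simp only [pairing_apply, ← mul_sum]
  simp [simpleRoot, Pi.single_apply]

theorem pairing_simpleRoot_left (γ : I → ℤ) (i : I) :
    C.pairing (C.simpleRoot i) γ = ∑ j, C.c j i * γ j := by
  rw [pairing_apply]
  refine sum_congr rfl fun j _ => ?_
  simp [simpleRoot, Pi.single_apply, mul_comm]

@[simp] theorem pairing_simpleRoot_simpleRoot (i j : I) :
    C.pairing (C.simpleRoot j) (C.simpleRoot i) = C.c i j := by
  rw [pairing_simpleRoot_right]
  simp [simpleRoot, Pi.single_apply]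

theorem sform_simpleRoot_left (i : I) (x : I → ℤ) :
    C.sform (C.simpleRoot i) x = C.d i * C.pairing x (C.simpleRoot i) := by
  rw [pairing_simpleRoot_right, sform_apply, sum_eq_single i]
  · simp [simpleRoot, mul_sum, mul_assoc]
  · intro j _ hj
    simp [simpleRoot, hj]
  · simp

theorem reflFun_eq (i : I) (x : I → ℤ) :
    C.reflFun i x = x - C.pairing x (C.simpleRoot i) • C.simpleRoot i := by
  rw [pairing_simpleRoot_right, reflFun]

theorem corootReflFun_eq (i : I) (γ : I → ℤ) :
    C.corootReflFun i γ = γ - C.pairing (C.simpleRoot i) γ • C.simpleRoot i := by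
  rw [pairing_simpleRoot_left, corootReflFun]

theorem pairing_reflFun (i : I) (x γ : I → ℤ) :
    C.pairing (C.reflFun i x) γ = C.pairing x (C.corootReflFun i γ) := by
  simp only [reflFun_eq, corootReflFun_eq, map_sub, map_smul, LinearMap.sub_apply,
    LinearMap.smul_apply, smul_eq_mul]
  ring

theorem corootReflFun_corootReflFun (i : I) (γ : I → ℤ) :
    C.corootReflFun i (C.corootReflFun i γ) = γ := by
  simp only [corootReflFun_eq, map_sub, map_smul, pairing_simpleRoot_simpleRoot, C.c_self,
    smul_eq_mul]
  module

theorem sform_reflFun (i : I) (x y : I → ℤ) :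
    C.sform (C.reflFun i x) (C.reflFun i y) = C.sform x y := by
  have h1 := C.sform_simpleRoot_left i x
  have h2 := C.sform_simpleRoot_left i y
  have h3 := C.sform_simpleRoot_left i (C.simpleRoot i)
  rw [pairing_simpleRoot_simpleRoot, C.c_self] at h3
  simp only [reflFun_eq, map_sub, map_smul, LinearMap.sub_apply,
    LinearMap.smul_apply, smul_eq_mul, C.sform_comm x (C.simpleRoot i), h1, h2, h3]
  ring

variable {C}

theorem IsFiniteType.sform_pos (hC : C.IsFiniteType) {x : I → ℤ} (hx : x ≠ 0) :
    0 < C.sform x x := by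
  have hx' : (fun i => (x i : ℝ)) ≠ 0 := fun h => hx <| funext fun i => by
    have := congrFun h i
    simpa using this
  have := Matrix.PosDef.dotProduct_mulVec_pos hC hx'
  have e : (Star.star fun i => (x i : ℝ)) ⬝ᵥ
      ((Matrix.of fun i j => (((C.d i : ℤ) * C.c i j : ℤ) : ℝ)).mulVec fun i => (x i : ℝ))
      = ((C.sform x x : ℤ) : ℝ) := by
    rw [sform_apply]
    simp [dotProduct, Matrix.mulVec, mul_sum, mul_assoc]
  rw [e] at this
  exact_mod_cast this

theorem IsFiniteType.sform_nonneg (hC : C.IsFiniteType) (x : I → ℤ) : 0 ≤ C.sform x x := by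
  by_cases hx : x = 0
  · simp [hx]
  · exact (hC.sform_pos hx).le

theorem IsFiniteType.cauchy_schwarz (hC : C.IsFiniteType) (x y : I → ℤ) :
    C.sform x y ^ 2 ≤ C.sform x x * C.sform y y := by
  by_cases hy : y = 0
  · simp [hy]
  have hp := hC.sform_pos hy
  have := hC.sform_nonneg (C.sform y y • x - C.sform x y • y)
  have e : C.sform (C.sform y y • x - C.sform x y • y) (C.sform y y • x - C.sform x y • y)
      = C.sform y y * (C.sform x x * C.sform y y - C.sform x y ^ 2) := by
    simp only [map_sub, map_smul, LinearMap.sub_apply,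
      LinearMap.smul_apply, smul_eq_mul, C.sform_comm y x]
    ring
  rw [e] at this
  have := nonneg_of_mul_nonneg_right this hp
  linarith

/-- The coroot of a root is its rescaling: `(β, β) β^∨ = 2 β`. -/
theorem IsRootPair.coroot_eq {β γ : I → ℤ} (h : C.IsRootPair β γ) :
    C.pairing β γ = 2 ∧ (∃ k, C.sform β β = 2 * C.d k) ∧
      ∀ j, γ j * C.sform β β = 2 * (β j * C.d j) := by
  induction h with
  | simple i =>
    have h3 := C.sform_simpleRoot_left i (C.simpleRoot i)
    rw [pairing_simpleRoot_simpleRoot, C.c_self] at h3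
    refine ⟨by simp [C.c_self], ⟨i, by rw [h3]; ring⟩, fun j => ?_⟩
    rw [h3]
    by_cases hj : j = i
    · subst hj
      ring
    · simp [simpleRoot, hj]
  | refl i β γ h ih =>
    obtain ⟨h1, h2, h3⟩ := ih
    refine ⟨by rw [pairing_reflFun, corootReflFun_corootReflFun, h1], by rwa [sform_reflFun],
      fun j => ?_⟩
    rw [sform_reflFun, reflFun, corootReflFun]
    have e : (∑ j, C.c j i * γ j) * C.sform β β = 2 * ((∑ j, C.c i j * β j) * C.d i) := by
      simp only [sum_mul, mul_sum]
      refine sum_congr rfl fun k _ => ?_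
      rw [mul_assoc, h3 k]
      linear_combination (2 * β k) * C.symm k i
    by_cases hj : j = i
    · subst hj
      simp only [simpleRoot, Pi.sub_apply, Pi.smul_apply, Pi.single_eq_same, smul_eq_mul, sub_mul,
        mul_one, e, h3]
      ring
    · simp [simpleRoot, hj, h3]

theorem IsRootPair.pairing_self {β γ : I → ℤ} (h : C.IsRootPair β γ) : C.pairing β γ = 2 :=
  h.coroot_eq.1

theorem IsRootPair.sform_self_pos {β γ : I → ℤ} (h : C.IsRootPair β γ) : 0 < C.sform β β := by
  obtain ⟨k, hk⟩ := h.coroot_eq.2.1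
  have := C.d_pos k
  omega

theorem IsRootPair.ne_zero {β γ : I → ℤ} (h : C.IsRootPair β γ) : β ≠ 0 := by
  rintro rfl
  simpa using h.sform_self_pos

/-- `⟨x, β^∨⟩ = 2 (β, x) / (β, β)`. -/
theorem IsRootPair.sform_mul_pairing {β γ : I → ℤ} (h : C.IsRootPair β γ) (x : I → ℤ) :
    C.sform β β * C.pairing x γ = 2 * C.sform β x := by
  rw [pairing_apply, sform_apply C β x]
  simp only [mul_sum]
  refine sum_congr rfl fun i _ => sum_congr rfl fun j _ => ?_
  linear_combination (C.c i j * x j) * h.coroot_eq.2.2 i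

theorem IsRootPair.coroot_unique {β γ γ' : I → ℤ} (h : C.IsRootPair β γ)
    (h' : C.IsRootPair β γ') : γ = γ' := by
  funext j
  have h1 := h.coroot_eq.2.2 j
  have h2 := h'.coroot_eq.2.2 j
  exact mul_right_cancel₀ h.sform_self_pos.ne' (h1.trans h2.symm)

theorem even_sum_of_symm {a : I → I → ℤ} (hs : ∀ i j, a i j = a j i) (hd : ∀ i, Even (a i i)) :
    Even (∑ i, ∑ j, a i j) := by
  have key : ∀ s : Finset I, Even (∑ i ∈ s, ∑ j ∈ s, a i j) := by
    intro s
    induction s using Finset.induction_on with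
    | empty => simp
    | insert x s hx ih =>
      have : ∑ i ∈ insert x s, ∑ j ∈ insert x s, a i j
          = a x x + 2 * (∑ j ∈ s, a x j) + ∑ i ∈ s, ∑ j ∈ s, a i j := by
        simp only [sum_insert hx, sum_add_distrib]
        rw [sum_congr rfl fun i (_ : i ∈ s) => hs i x]
        ring
      rw [this]
      exact ((hd x).add (even_two_mul _)).add ih
  exact key univ

/-- If `x` is a vector whose rescaling `2 x / (β, β)` is a vector `y` of the coroot lattice, then
`(x, x)` is a multiple of `(β, β)`, so at least `(β, β)` when `x ≠ 0`. -/
theorem IsFiniteType.le_sform_of_rescale (hC : C.IsFiniteType) {N : ℤ} (hN : 0 < N)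
    {x y : I → ℤ} (h : ∀ j, y j * N = 2 * (x j * C.d j)) (hx : x ≠ 0) : N ≤ C.sform x x := by
  have hev : Even (∑ i, ∑ j, y i * (C.c i j * x j)) := by
    apply even_sum_of_symm
    · intro i j
      refine mul_right_cancel₀ hN.ne' ?_
      linear_combination (C.c i j * x j) * h i - (C.c j i * x i) * h j
        + 2 * x i * x j * C.symm i j
    · intro i
      rw [C.c_self]
      exact ⟨y i * x i, by ring⟩
  obtain ⟨m, hm⟩ := hev
  have e : N * (m + m) = 2 * C.sform x x := by
    rw [← hm, sform_apply]
    simp only [mul_sum]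
    refine sum_congr rfl fun i _ => sum_congr rfl fun j _ => ?_
    linear_combination (C.c i j * x j) * h i
  have hp := hC.sform_pos hx
  have : 0 < m := by
    by_contra hcon
    have : N * m ≤ 0 := mul_nonpos_of_nonneg_of_nonpos hN.le (by omega)
    linarith
  nlinarith

/-- Every root is positive or negative: otherwise its positive and negative parts `p`, `m` would
satisfy `(p, m) ≤ 0` and, by `IsFiniteType.le_sform_of_rescale`, each be at least as long as the
root `p - m` itself. -/
theorem IsRootPair.nonneg_or_nonpos (hC : C.IsFiniteType) {β γ : I → ℤ}
    (h : C.IsRootPair β γ) : 0 ≤ β ∨ β ≤ 0 := by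
  by_contra! hcon
  obtain ⟨h1, h2⟩ := hcon
  have hN := h.sform_self_pos
  have hsgn : ∀ j, (max (γ j) 0) * C.sform β β = 2 * (max (β j) 0 * C.d j) ∧
      (max (-γ j) 0) * C.sform β β = 2 * (max (-β j) 0 * C.d j) := by
    intro j
    have e := h.coroot_eq.2.2 j
    have hd : (0 : ℤ) < C.d j := by exact_mod_cast C.d_pos j
    rcases le_total 0 (β j) with hb | hb
    · have hg : 0 ≤ γ j := by
        refine nonneg_of_mul_nonneg_left (b := C.sform β β) ?_ hN
        rw [e]
        positivity
      rw [max_eq_left hb, max_eq_left hg, max_eq_right (by linarith), max_eq_right (by linarith)]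
      exact ⟨e, by simp⟩
    · have hg : γ j ≤ 0 := by
        have : 0 ≤ (-γ j) * C.sform β β := by nlinarith
        have := nonneg_of_mul_nonneg_left this hN
        linarith
      rw [max_eq_right hb, max_eq_right hg, max_eq_left (by linarith), max_eq_left (by linarith)]
      exact ⟨by simp, by linarith⟩
  set p : I → ℤ := fun j => max (β j) 0 with hp
  set m : I → ℤ := fun j => max (-β j) 0 with hm
  have hp0 : p ≠ 0 := fun h0 => h2 fun j => by
    have := congrFun h0 j
    simpa [hp] using this
  have hm0 : m ≠ 0 := fun h0 => h1 fun j => by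
    have := congrFun h0 j
    simpa [hm] using this
  have hβ : β = p - m := by
    funext j
    simp only [hp, hm, Pi.sub_apply]
    omega
  have hpp := hC.le_sform_of_rescale hN (x := p) (fun j => (hsgn j).1) hp0
  have hmm := hC.le_sform_of_rescale hN (x := m) (fun j => (hsgn j).2) hm0
  have hpm : C.sform p m ≤ 0 := by
    rw [sform_apply]
    refine sum_nonpos fun i _ => sum_nonpos fun j _ => ?_
    by_cases hij : i = j
    · subst hij
      have : p i * m i = 0 := by
        simp only [hp, hm]
        rcases le_total 0 (β i) with hb | hb
        · rw [max_eq_right (a := -β i) (by linarith), mul_zero]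
        · rw [max_eq_right hb, zero_mul]
      exact le_of_eq (by linear_combination ((C.d i : ℤ) * C.c i i) * this)
    · have h3 : 0 ≤ p i := le_max_right _ _
      have h4 : 0 ≤ m j := le_max_right _ _
      exact mul_nonpos_of_nonpos_of_nonneg (mul_nonpos_of_nonneg_of_nonpos h3
        (mul_nonpos_of_nonneg_of_nonpos (by positivity) (C.c_nonpos i j hij))) h4
  have e : C.sform β β = C.sform p p + C.sform m m - 2 * C.sform p m := by
    rw [hβ]
    simp only [map_sub, LinearMap.sub_apply, C.sform_comm m p]
    ring
  linarith

theorem IsRootPair.nonpos_of_not_nonneg (hC : C.IsFiniteType) {β γ : I → ℤ}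
    (h : C.IsRootPair β γ) (hn : ¬ 0 ≤ β) : β ≤ 0 :=
  (h.nonneg_or_nonpos hC).resolve_left hn

theorem IsRootPair.not_nonneg_of_nonpos {β γ : I → ℤ}
    (h : C.IsRootPair β γ) (hn : β ≤ 0) : ¬ 0 ≤ β :=
  fun h0 => h.ne_zero (le_antisymm hn h0)

theorem simpleRoot_nonneg (i : I) : 0 ≤ C.simpleRoot i :=
  Pi.single_nonneg.2 zero_le_one

/-- Reflections in arbitrary roots preserve the roots. -/
theorem IsRootPair.reflect {β γ : I → ℤ} (h : C.IsRootPair β γ) :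
    ∀ {δ ε : I → ℤ}, C.IsRootPair δ ε →
      C.IsRootPair (δ - C.pairing δ γ • β) (ε - C.pairing β ε • γ) := by
  induction h with
  | simple i =>
    intro δ ε h
    rw [← reflFun_eq, ← corootReflFun_eq]
    exact h.refl i _ _
  | refl i β γ h ih =>
    intro δ ε h'
    have := (ih (h'.refl i _ _)).refl i
    convert this using 1
    · rw [← C.pairing_reflFun i δ γ, C.reflFun_eq i (_ - _ : I → ℤ)]
      simp only [map_sub, map_smul, LinearMap.sub_apply, LinearMap.smul_apply]
      rw [C.reflFun_eq i β]
      have := C.reflFun_reflFun i δ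
      nth_rewrite 1 [← this]
      rw [C.reflFun_eq i (C.reflFun i δ)]
      simp only [smul_eq_mul]
      module
    · rw [C.pairing_reflFun i β ε, C.corootReflFun_eq i (_ - _ : I → ℤ)]
      simp only [map_sub, map_smul]
      rw [C.corootReflFun_eq i γ]
      have := C.corootReflFun_corootReflFun i ε
      nth_rewrite 1 [← this]
      rw [C.corootReflFun_eq i (C.corootReflFun i ε)]
      simp only [smul_eq_mul]
      module

theorem IsRootPair.neg {β γ : I → ℤ} (h : C.IsRootPair β γ) : C.IsRootPair (-β) (-γ) := by
  have := h.reflect h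
  rw [h.pairing_self] at this
  convert this using 1 <;> module

/-- The only positive multiple of `α i` that is a root is `α i`. -/
theorem IsRootPair.eq_simpleRoot {β γ : I → ℤ} (h : C.IsRootPair β γ) (hβ : 0 ≤ β) {i : I}
    (hi : ∀ j, j ≠ i → β j = 0) : β = C.simpleRoot i ∧ γ = C.simpleRoot i := by
  have e : β = β i • C.simpleRoot i := by
    funext j
    by_cases hj : j = i
    · subst hj
      simp [simpleRoot]
    · simp [simpleRoot, hj, hi j hj]
  have eγ : γ = γ i • C.simpleRoot i := by
    funext j
    by_cases hj : j = i
    · subst hj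
      simp [simpleRoot]
    · have := h.coroot_eq.2.2 j
      rw [hi j hj] at this
      have h0 : γ j * C.sform β β = 0 := by linarith
      simp [simpleRoot, hj, (mul_eq_zero.1 h0).resolve_right h.sform_self_pos.ne']
  have h2 := h.pairing_self
  rw [e, eγ] at h2
  simp only [map_smul, LinearMap.smul_apply, pairing_simpleRoot_simpleRoot, C.c_self,
    smul_eq_mul] at h2
  have h3 : β i * γ i = 1 := by
    have : 2 * (β i * γ i) = 2 * 1 := by linarith
    exact mul_left_cancel₀ two_ne_zero this
  have h4 : β i = 1 := Int.eq_one_of_mul_eq_one_right (hβ i) h3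
  have h5 : γ i = 1 := by rw [h4] at h3; linarith
  rw [e, eγ]
  simp [h4, h5]

/-- `s i` sends every positive root other than `α i` to a positive root. -/
theorem IsRootPair.reflFun_nonneg (hC : C.IsFiniteType) {β γ : I → ℤ} (h : C.IsRootPair β γ)
    (hβ : 0 ≤ β) {i : I} (hi : β ≠ C.simpleRoot i) : 0 ≤ C.reflFun i β := by
  by_contra hn
  have hle := (h.refl i _ _).nonpos_of_not_nonneg hC hn
  refine hi (h.eq_simpleRoot hβ fun j hj => ?_).1
  have h1 := hle j
  rw [reflFun] at h1
  simp only [simpleRoot, Pi.sub_apply, Pi.smul_apply, Pi.single_apply, hj, if_false, smul_zero,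
    sub_zero] at h1
  exact le_antisymm h1 (hβ j)

theorem reflFun_simpleRoot (i : I) : C.reflFun i (C.simpleRoot i) = -C.simpleRoot i := by
  rw [reflFun_eq, pairing_simpleRoot_simpleRoot, C.c_self]
  module

theorem IsFiniteType.finite_rootPairs (hC : C.IsFiniteType) :
    {p : (I → ℤ) × (I → ℤ) | C.IsRootPair p.1 p.2}.Finite := by
  let S : Matrix I I ℤ := Matrix.of fun i j => (C.d i : ℤ) * C.c i j
  have hS : ∀ x y, C.sform x y = x ⬝ᵥ S.mulVec y := fun x y => by
    simp [sform_apply, dotProduct, Matrix.mulVec, S, mul_sum, mul_assoc]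
  have hdet : S.det ≠ 0 := by
    intro h0
    obtain ⟨v, hv, hv0⟩ := Matrix.exists_mulVec_eq_zero_iff.2 h0
    have := hC.sform_pos hv
    rw [hS, hv0, dotProduct_zero] at this
    exact lt_irrefl _ this
  have hadj : ∀ j x, C.sform (S.adjugate j) x = S.det * x j := by
    intro j x
    rw [hS]
    change (S.adjugate.mulVec (S.mulVec x)) j = _
    rw [Matrix.mulVec_mulVec, Matrix.adjugate_mul, Matrix.smul_mulVec, Matrix.one_mulVec]
    simp
  let B : ℤ := ∑ j, C.sform (S.adjugate j) (S.adjugate j) * ∑ k, 2 * (C.d k : ℤ)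
  have hbound : ∀ β γ, C.IsRootPair β γ → ∀ j, β j ∈ Set.Icc (-B) B := by
    intro β γ h j
    have h1 := hC.cauchy_schwarz (S.adjugate j) β
    rw [hadj] at h1
    obtain ⟨k, hk⟩ := h.coroot_eq.2.1
    have h2 : C.sform β β ≤ ∑ k, 2 * (C.d k : ℤ) := by
      rw [hk]
      exact single_le_sum (f := fun k => 2 * (C.d k : ℤ)) (fun _ _ => by positivity) (mem_univ k)
    have h3 : C.sform (S.adjugate j) (S.adjugate j) * C.sform β β ≤ B := by
      refine (mul_le_mul_of_nonneg_left h2 (hC.sform_nonneg _)).trans ?_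
      exact single_le_sum (f := fun j => C.sform (S.adjugate j) (S.adjugate j) *
        ∑ k, 2 * (C.d k : ℤ)) (fun i _ => mul_nonneg (hC.sform_nonneg _)
          (sum_nonneg fun _ _ => by positivity)) (mem_univ j)
    have h4 : 1 ≤ S.det ^ 2 := by
      have : 0 < S.det ^ 2 := by positivity
      omega
    have h5 : β j ^ 2 ≤ B := by nlinarith [sq_nonneg (β j)]
    have h6 : |β j| ≤ β j ^ 2 := by
      rw [← sq_abs]
      rcases (abs_nonneg (β j)).eq_or_lt with h0 | h0
      · rw [← h0]
        norm_num
      · nlinarith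
    exact abs_le.1 (h6.trans h5)
  have hfin : {β : I → ℤ | ∃ γ, C.IsRootPair β γ}.Finite := by
    refine (Set.Finite.pi' (t := fun _ : I => Set.Icc (-B) B) fun _ => Set.finite_Icc _ _).subset ?_
    rintro β ⟨γ, h⟩ j
    exact hbound β γ h j
  refine Set.Finite.of_finite_image (f := Prod.fst) (hfin.subset ?_) ?_
  · rintro _ ⟨p, hp, rfl⟩
    exact ⟨p.2, hp⟩
  · rintro ⟨β, γ⟩ h ⟨β', γ'⟩ h' (rfl : β = β')
    exact Prod.ext rfl (IsRootPair.coroot_unique h h')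

end Forms

/-! ### Rank two: braid relations for deformed reflections -/

section Braid

/-- The alternating word `(i, j, i, …)` with `n` letters. -/
def altWord {I : Type*} : ℕ → I → I → List I
  | 0, _, _ => []
  | n + 1, i, j => i :: altWord n j i

/-- The letter that follows `altWord n i j` in the alternating pattern. -/
def altNext {I : Type*} : ℕ → I → I → I
  | 0, i, _ => i
  | n + 1, i, j => altNext n j i

theorem altWord_succ {I : Type*} (n : ℕ) (i j : I) :
    altWord (n + 1) i j = altWord n i j ++ [altNext n i j] := by
  induction n generalizing i j with
  | zero => rfl
  | succ n ih =>
    rw [altWord, ih j i]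
    rfl

@[simp] theorem length_altWord {I : Type*} (n : ℕ) (i j : I) : (altWord n i j).length = n := by
  induction n generalizing i j with
  | zero => rfl
  | succ n ih => simp [altWord, ih]

/-- The order of `s i * s j` in finite type, in terms of the product `c i j * c j i`. -/
def braidOrder {I : Type*} (C : SymGCM I) (i j : I) : ℕ :=
  if C.c i j * C.c j i = 0 then 2 else if C.c i j * C.c j i = 1 then 3
  else if C.c i j * C.c j i = 2 then 4 else 6

/-- The coefficients of `e i` and `e j` in `x - (⋯ τ i τ j τ i) x` (`n` factors in total, the
leftmost being `τ i`), where `τ i x = x - φ i x • e i`, `u = φ i x`, `v = φ j x`,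
`b = φ i (e j)`, `c = φ j (e i)`, `φ i (e i) = 1 + P` and `φ j (e j) = 1 + Q`. -/
def altCoeff {R : Type*} [CommRing R] (u v b c P Q : R) : ℕ → R × R
  | 0 => (0, 0)
  | n + 1 => (u - P * (altCoeff v u c b Q P n).2 - b * (altCoeff v u c b Q P n).1,
      (altCoeff v u c b Q P n).1)

theorem prod_altWord_apply {R M I : Type*} [CommRing R] [AddCommGroup M] [Module R M]
    {τ : I → Module.End R M} {e : I → M} {φ : I → Module.Dual R M}
    (hτ : ∀ i x, τ i x = x - φ i x • e i) {P : I → R} (hP : ∀ i, φ i (e i) = 1 + P i)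
    (n : ℕ) (i j : I) (x : M) :
    ((altWord n i j).map τ).prod x =
      x - (altCoeff (φ i x) (φ j x) (φ i (e j)) (φ j (e i)) (P i) (P j) n).1 • e i
        - (altCoeff (φ i x) (φ j x) (φ i (e j)) (φ j (e i)) (P i) (P j) n).2 • e j := by
  induction n generalizing i j with
  | zero => simp [altWord, altCoeff]
  | succ n ih =>
    rw [altWord, List.map_cons, List.prod_cons, Module.End.mul_apply, ih j i, hτ]
    simp only [map_sub, map_smul, smul_eq_mul, hP, altCoeff]
    module

/-- The deformed reflections `τ i x = x - φ i x • e i` satisfy the braid relations if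
`φ i (e i) = 1 + X i ^ 2` and `φ i (e j) * φ j (e i)` is `0`, `X i ^ 2` (with `X i = X j`),
`X i ^ 2 + X j ^ 2` or `X i ^ 2 + X i * X j + X j ^ 2` according to the value of
`c i j * c j i`. -/
theorem braid_relation {R M I : Type*} [CommRing R] [AddCommGroup M] [Module R M] (C : SymGCM I)
    {τ : I → Module.End R M} {e : I → M} {φ : I → Module.Dual R M}
    (hτ : ∀ i x, τ i x = x - φ i x • e i) {X : I → R} (hX : ∀ i, φ i (e i) = 1 + X i ^ 2)
    {i j : I} (h3 : C.c i j * C.c j i ≤ 3) (h0 : 0 ≤ C.c i j * C.c j i)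
    (hc0 : C.c i j * C.c j i = 0 → φ i (e j) = 0 ∧ φ j (e i) = 0)
    (hc1 : C.c i j * C.c j i = 1 → X i = X j ∧ φ i (e j) * φ j (e i) = X i ^ 2)
    (hc2 : C.c i j * C.c j i = 2 → φ i (e j) * φ j (e i) = X i ^ 2 + X j ^ 2)
    (hc3 : C.c i j * C.c j i = 3 → φ i (e j) * φ j (e i) = X i ^ 2 + X j ^ 2 + X i * X j) :
    ((altWord (C.braidOrder i j) i j).map τ).prod
      = ((altWord (C.braidOrder i j) j i).map τ).prod := by
  ext x
  rw [prod_altWord_apply hτ hX, prod_altWord_apply hτ hX, sub_right_comm]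
  suffices h : ∀ u v : R,
      (altCoeff u v (φ i (e j)) (φ j (e i)) (X i ^ 2) (X j ^ 2) (C.braidOrder i j)).1 =
      (altCoeff v u (φ j (e i)) (φ i (e j)) (X j ^ 2) (X i ^ 2) (C.braidOrder i j)).2 ∧
      (altCoeff u v (φ i (e j)) (φ j (e i)) (X i ^ 2) (X j ^ 2) (C.braidOrder i j)).2 =
      (altCoeff v u (φ j (e i)) (φ i (e j)) (X j ^ 2) (X i ^ 2) (C.braidOrder i j)).1 by
    rw [(h _ _).1, (h _ _).2]
  intro u v
  generalize φ i (e j) = b at *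
  generalize φ j (e i) = c at *
  generalize X i = P at *
  generalize X j = Q at *
  obtain h | h | h | h : C.c i j * C.c j i = 0 ∨ C.c i j * C.c j i = 1 ∨
      C.c i j * C.c j i = 2 ∨ C.c i j * C.c j i = 3 := by omega
  · obtain ⟨rfl, rfl⟩ := hc0 h
    have : C.braidOrder i j = 2 := by simp [braidOrder, h]
    rw [this]
    simp [altCoeff]
  · obtain ⟨rfl, h'⟩ := hc1 h
    have : C.braidOrder i j = 3 := by simp [braidOrder, h]
    rw [this]
    simp only [altCoeff]
    constructor <;> grind
  · have h' := hc2 h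
    have : C.braidOrder i j = 4 := by simp [braidOrder, h]
    rw [this]
    simp only [altCoeff]
    generalize P ^ 2 = P at *
    generalize Q ^ 2 = Q at *
    constructor <;> grind
  · have h' := hc3 h
    have : C.braidOrder i j = 6 := by simp [braidOrder, h]
    rw [this]
    simp only [altCoeff]
    have hS : P ^ 2 * Q ^ 2 = (P * Q) ^ 2 := by ring
    clear hc0 hc1 hc2 hc3
    generalize P * Q = S at *
    generalize P ^ 2 = P at *
    generalize Q ^ 2 = Q at *
    constructor <;> grind

end Braid

/-! ### Reduced words: the exchange property and Matsumoto's theorem -/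

section Weyl

variable {I : Type*} [Fintype I] [DecidableEq I] {C : SymGCM I}

theorem IsFiniteType.c_mul_c_le (hC : C.IsFiniteType) {i j : I} (hij : i ≠ j) :
    C.c i j * C.c j i ≤ 3 := by
  have hx : (2 : ℤ) • C.simpleRoot j - C.c i j • C.simpleRoot i ≠ 0 := fun h => by
    have := congrFun h j
    simp [simpleRoot, hij.symm] at this
  have := hC.sform_pos hx
  simp only [map_sub, map_smul, LinearMap.sub_apply, LinearMap.smul_apply, smul_eq_mul,
    sform_simpleRoot_left, pairing_simpleRoot_simpleRoot, C.c_self] at this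
  have h2 := C.symm i j
  have hd : (0 : ℤ) < C.d j := by exact_mod_cast C.d_pos j
  have e : (2 * C.d j) * (4 - C.c i j * C.c j i) > 0 := by
    have e1 : (C.d i : ℤ) * C.c i j * C.c i j = C.d j * C.c j i * C.c i j := by rw [h2]
    linarith
  have := pos_of_mul_pos_right e (by positivity)
  omega

theorem c_mul_c_nonneg (C : SymGCM I) {i j : I} (hij : i ≠ j) : 0 ≤ C.c i j * C.c j i :=
  mul_nonneg_of_nonpos_of_nonpos (C.c_nonpos i j hij) (C.c_nonpos j i hij.symm)

theorem s_apply (i : I) (x : I → ℤ) : C.s i x = C.reflFun i x := rfl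

theorem s_mul_s (i : I) : C.s i * C.s i = 1 :=
  LinearEquiv.ext fun x => C.reflFun_reflFun i x

theorem s_inv (i : I) : (C.s i)⁻¹ = C.s i := inv_eq_of_mul_eq_one_left (s_mul_s i)

@[simp] theorem sword_nil : C.sword [] = 1 := rfl

@[simp] theorem sword_cons (i : I) (ω : List I) : C.sword (i :: ω) = C.s i * C.sword ω := rfl

@[simp] theorem sword_append (ω ω' : List I) : C.sword (ω ++ ω') = C.sword ω * C.sword ω' := by
  simp [sword]

theorem sword_mem (ω : List I) : C.sword ω ∈ C.weylGroup := by
  refine Subgroup.list_prod_mem _ fun x hx => ?_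
  obtain ⟨i, -, rfl⟩ := List.mem_map.1 hx
  exact Subgroup.subset_closure ⟨i, rfl⟩

theorem IsRootPair.weyl_apply {β γ : I → ℤ} (h : C.IsRootPair β γ)
    {w : (I → ℤ) ≃ₗ[ℤ] (I → ℤ)} (hw : w ∈ C.weylGroup) :
    ∃ γ', C.IsRootPair (w β) γ' := by
  obtain ⟨ω, hω⟩ := C.exists_word ⟨w, hw⟩
  change _ = w at hω
  subst hω
  clear hw
  induction ω with
  | nil => exact ⟨γ, h⟩
  | cons i ω ih =>
    obtain ⟨γ', h'⟩ := ih
    exact ⟨_, h'.refl i⟩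

theorem sform_weyl {w : (I → ℤ) ≃ₗ[ℤ] (I → ℤ)} (hw : w ∈ C.weylGroup) (x y : I → ℤ) :
    C.sform (w x) (w y) = C.sform x y := by
  obtain ⟨ω, hω⟩ := C.exists_word ⟨w, hw⟩
  change _ = w at hω
  subst hω
  clear hw
  induction ω with
  | nil => rfl
  | cons i ω ih => exact (C.sform_reflFun i _ _).trans ih

theorem sform_simpleRoot_self (i : I) :
    C.sform (C.simpleRoot i) (C.simpleRoot i) = 2 * C.d i := by
  rw [sform_simpleRoot_left, pairing_simpleRoot_simpleRoot, C.c_self, mul_comm]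

theorem d_eq_of_weyl_apply {w : (I → ℤ) ≃ₗ[ℤ] (I → ℤ)} (hw : w ∈ C.weylGroup) {i k : I} {e : ℤ}
    (he : e * e = 1) (h : w (C.simpleRoot k) = e • C.simpleRoot i) : C.d k = C.d i := by
  have h1 := sform_weyl hw (C.simpleRoot k) (C.simpleRoot k)
  rw [h] at h1
  simp only [map_smul, LinearMap.smul_apply, smul_eq_mul, sform_simpleRoot_self] at h1
  have : 2 * (C.d k : ℤ) = 2 * C.d i := by linear_combination -h1 + 2 * (C.d i : ℤ) * he
  omega

/-- If `w` sends `α k` to `± α i`, then it conjugates `s k` to `s i`. -/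
theorem weyl_mul_s {w : (I → ℤ) ≃ₗ[ℤ] (I → ℤ)} (hw : w ∈ C.weylGroup) {i k : I} {e : ℤ}
    (he : e * e = 1) (h : w (C.simpleRoot k) = e • C.simpleRoot i) : w * C.s k = C.s i * w := by
  refine LinearEquiv.ext fun x => ?_
  simp only [LinearEquiv.mul_apply, s_apply, reflFun_eq, map_sub, map_smul, h]
  congr 1
  rw [smul_smul]
  congr 1
  have hd := d_eq_of_weyl_apply hw he h
  have h1 := sform_weyl hw (C.simpleRoot k) x
  rw [h] at h1
  simp only [map_smul, LinearMap.smul_apply, smul_eq_mul, sform_simpleRoot_left, hd] at h1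
  have hd0 : (C.d i : ℤ) ≠ 0 := by exact_mod_cast (C.d_pos i).ne'
  refine mul_left_cancel₀ hd0 ?_
  linear_combination -e * h1 + (C.d i : ℤ) * C.pairing (w x) (C.simpleRoot i) * he

/-- The exchange property: if `w⁻¹` makes `α i` negative, a letter can be removed from any word
for `w` to obtain a word for `s i * w`. -/
theorem exists_word_of_not_nonneg (hC : C.IsFiniteType) (i : I) (ω : List I)
    (h : ¬ 0 ≤ (C.sword ω)⁻¹ (C.simpleRoot i)) :
    ∃ ω', C.sword ω' = C.s i * C.sword ω ∧ ω'.length + 1 = ω.length := by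
  induction ω using List.reverseRecOn with
  | nil => exact absurd (simpleRoot_nonneg (C := C) i) h
  | append_singleton ω k ih =>
    by_cases h0 : 0 ≤ (C.sword ω)⁻¹ (C.simpleRoot i)
    · have e : (C.sword (ω ++ [k]))⁻¹ (C.simpleRoot i)
          = C.reflFun k ((C.sword ω)⁻¹ (C.simpleRoot i)) := by
        rw [sword_append, mul_inv_rev, LinearEquiv.mul_apply]
        simp [s_inv, s_apply]
      rw [e] at h
      obtain ⟨γ, hγ⟩ := (IsRootPair.simple (C := C) i).weyl_apply (inv_mem (sword_mem ω))
      have h1 : (C.sword ω)⁻¹ (C.simpleRoot i) = C.simpleRoot k := by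
        by_contra hne
        exact h (hγ.reflFun_nonneg hC h0 hne)
      have h2 : C.sword ω (C.simpleRoot k) = (1 : ℤ) • C.simpleRoot i := by
        rw [← h1, ← LinearEquiv.mul_apply, mul_inv_cancel, one_smul]
        rfl
      refine ⟨ω, ?_, by simp⟩
      rw [sword_append, ← mul_assoc, ← weyl_mul_s (sword_mem ω) (one_mul 1) h2]
      simp [mul_assoc, s_mul_s]
    · obtain ⟨ω', h1, h2⟩ := ih h0
      exact ⟨ω' ++ [k], by simp [h1, mul_assoc], by simp [h2]⟩

/-- The word `ω` is reduced: no shorter word represents the same element of `W`. -/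
def Reduced (C : SymGCM I) (ω : List I) : Prop :=
  ∀ ω', C.sword ω' = C.sword ω → ω.length ≤ ω'.length

theorem isReducedWord_iff {ω : List I} {w : C.weylGroup} :
    C.IsReducedWord ω w ↔ C.sword ω = w ∧ C.Reduced ω := by
  constructor
  · rintro ⟨h1, h2⟩
    refine ⟨h1, fun ω' h => ?_⟩
    rw [h2]
    exact Nat.sInf_le ⟨ω', h.trans h1, rfl⟩
  · rintro ⟨h1, h2⟩
    refine ⟨h1, le_antisymm ?_ (Nat.sInf_le ⟨ω, h1, rfl⟩)⟩
    obtain ⟨ω', h3, h4⟩ := C.exists_reducedWord w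
    rw [← h4]
    exact h2 ω' (h3.trans h1.symm)

theorem Reduced.of_cons {i : I} {ω : List I} (h : C.Reduced (i :: ω)) : C.Reduced ω := by
  intro ω' h'
  have := h (i :: ω') (by simp [h'])
  simpa using this

theorem Reduced.nonneg_of_cons (hC : C.IsFiniteType) {i : I} {ω : List I}
    (h : C.Reduced (i :: ω)) : 0 ≤ (C.sword ω)⁻¹ (C.simpleRoot i) := by
  by_contra hn
  obtain ⟨ω', h1, h2⟩ := exists_word_of_not_nonneg hC i ω hn
  have := h ω' h1
  simp only [List.length_cons] at this
  omega

theorem sword_cons_inv_apply (i : I) (ω : List I) (x : I → ℤ) :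
    (C.sword (i :: ω))⁻¹ x = (C.sword ω)⁻¹ (C.reflFun i x) := by
  rw [sword_cons, mul_inv_rev, s_inv]
  rfl

theorem Reduced.not_nonneg_of_cons (hC : C.IsFiniteType) {i : I} {ω : List I}
    (h : C.Reduced (i :: ω)) : ¬ 0 ≤ (C.sword (i :: ω))⁻¹ (C.simpleRoot i) := by
  have h1 := h.nonneg_of_cons hC
  obtain ⟨γ, hγ⟩ := (IsRootPair.simple (C := C) i).weyl_apply (inv_mem (sword_mem ω))
  rw [sword_cons_inv_apply, reflFun_simpleRoot, map_neg]
  exact hγ.neg.not_nonneg_of_nonpos (neg_nonpos.2 h1)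

/-- The coefficients of `α i` and `α j` in the root `s i s j s i ⋯ α` (`n` reflections), in terms
of `x = - c i j` and `y = - c j i`. -/
def dihedralCoeff : ℕ → ℤ → ℤ → ℤ × ℤ
  | 0, _, _ => (1, 0)
  | n + 1, x, y => (x * (dihedralCoeff n y x).1 - (dihedralCoeff n y x).2,
      (dihedralCoeff n y x).1)

theorem sword_altWord_apply (n : ℕ) (i j : I) :
    C.sword (altWord n i j) (C.simpleRoot (altNext n i j))
      = (dihedralCoeff n (-C.c i j) (-C.c j i)).1 • C.simpleRoot i
        + (dihedralCoeff n (-C.c i j) (-C.c j i)).2 • C.simpleRoot j := by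
  induction n generalizing i j with
  | zero => simp [altWord, altNext, dihedralCoeff]
  | succ n ih =>
    rw [altWord, altNext, sword_cons, LinearEquiv.mul_apply, ih j i, s_apply, reflFun_eq]
    simp only [map_add, map_smul, LinearMap.add_apply, LinearMap.smul_apply,
      pairing_simpleRoot_simpleRoot, C.c_self, smul_eq_mul, dihedralCoeff]
    module

theorem dihedralCoeff_nonneg (hC : C.IsFiniteType) {i j : I} (hij : i ≠ j) {n : ℕ}
    (hn : n < C.braidOrder i j) :
    0 ≤ (dihedralCoeff n (-C.c i j) (-C.c j i)).1 ∧
      0 ≤ (dihedralCoeff n (-C.c i j) (-C.c j i)).2 := by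
  have h3 := hC.c_mul_c_le hij
  have hx := neg_nonneg.2 (C.c_nonpos i j hij)
  have hy := neg_nonneg.2 (C.c_nonpos j i hij.symm)
  have hz := C.c_zero_iff i j
  unfold braidOrder at hn
  rw [← neg_mul_neg] at h3 hn
  rw [← neg_eq_zero, ← neg_eq_zero (a := C.c j i)] at hz
  generalize -C.c i j = x at *
  generalize -C.c j i = y at *
  by_cases hx0 : x = 0
  · have hy0 := hz.1 hx0
    subst hx0 hy0
    simp only [mul_zero, if_true] at hn
    interval_cases n <;> simp [dihedralCoeff]
  · have hy0 : y ≠ 0 := fun h => hx0 (hz.2 h)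
    have hx1 : 1 ≤ x := by omega
    have hy1 : 1 ≤ y := by omega
    have hx3 : x ≤ 3 := by nlinarith
    have hy3 : y ≤ 3 := by nlinarith
    clear hz hx hy hx0 hy0
    interval_cases x <;> interval_cases y <;> first | omega | skip
    all_goals
      norm_num at hn
      interval_cases n <;> simp [dihedralCoeff]

/-- If both `i` and `j` are left descents of `w`, then `w` has a reduced word that begins with
the alternating word of length `n ≤ m i j`. -/
theorem exists_altWord_append (hC : C.IsFiniteType) {i j : I} (hij : i ≠ j) (ω : List I)
    (hi : ¬ 0 ≤ (C.sword ω)⁻¹ (C.simpleRoot i)) (hj : ¬ 0 ≤ (C.sword ω)⁻¹ (C.simpleRoot j))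
    (n : ℕ) (hn : n ≤ C.braidOrder i j) :
    ∃ ω', C.sword (altWord n i j ++ ω') = C.sword ω ∧ n + ω'.length = ω.length := by
  induction n with
  | zero => exact ⟨ω, by simp [altWord], by simp⟩
  | succ n ih =>
    obtain ⟨ω', h1, h2⟩ := ih (by omega)
    have hinv : ∀ k, (C.sword ω)⁻¹ (C.simpleRoot k) ≤ 0 ∨ 0 ≤ (C.sword ω)⁻¹ (C.simpleRoot k) := by
      intro k
      obtain ⟨γ, hγ⟩ := (IsRootPair.simple (C := C) k).weyl_apply (inv_mem (sword_mem ω))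
      exact (hγ.nonneg_or_nonpos hC).symm
    have hi' := (hinv i).resolve_right hi
    have hj' := (hinv j).resolve_right hj
    have e : (C.sword ω')⁻¹ (C.simpleRoot (altNext n i j))
        = (C.sword ω)⁻¹ (C.sword (altWord n i j) (C.simpleRoot (altNext n i j))) := by
      rw [← h1, sword_append, mul_inv_rev, LinearEquiv.mul_apply, ← LinearEquiv.mul_apply
        (C.sword (altWord n i j))⁻¹, inv_mul_cancel]
      rfl
    have hneg : ¬ 0 ≤ (C.sword ω')⁻¹ (C.simpleRoot (altNext n i j)) := by
      obtain ⟨γ, hγ⟩ := (IsRootPair.simple (C := C) (altNext n i j)).weyl_apply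
        (inv_mem (sword_mem ω'))
      refine hγ.not_nonneg_of_nonpos ?_
      rw [e, sword_altWord_apply, map_add, map_smul, map_smul]
      obtain ⟨ha, hb⟩ := dihedralCoeff_nonneg hC hij (show n < C.braidOrder i j by omega)
      exact add_nonpos (smul_nonpos_of_nonneg_of_nonpos ha hi')
        (smul_nonpos_of_nonneg_of_nonpos hb hj')
    obtain ⟨ω'', h3, h4⟩ := exists_word_of_not_nonneg hC _ _ hneg
    refine ⟨ω'', ?_, by omega⟩
    rw [altWord_succ, ← h1]
    simp [h3, s_mul_s, ← mul_assoc (C.s _)]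

/-- The braid relations in the Weyl group. -/
theorem sword_braid (hC : C.IsFiniteType) {i j : I} (hij : i ≠ j) :
    C.sword (altWord (C.braidOrder i j) i j) = C.sword (altWord (C.braidOrder i j) j i) := by
  let F : ((I → ℤ) ≃ₗ[ℤ] (I → ℤ)) →* Module.End ℤ (I → ℤ) :=
    LinearEquiv.automorphismGroup.toLinearMapMonoidHom
  have hF : Function.Injective F := LinearEquiv.toLinearMap_injective
  have key := braid_relation C (τ := fun i => F (C.s i)) (e := C.simpleRoot)
    (φ := fun i => C.pairing.flip (C.simpleRoot i)) (X := fun _ => (1 : ℤ))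
    (fun i x => C.reflFun_eq i x) (fun i => by simp [C.c_self])
    (hC.c_mul_c_le hij) (C.c_mul_c_nonneg hij)
    (fun h => by
      rcases mul_eq_zero.1 h with h | h
      · exact ⟨by simp [h], by simp [(C.c_zero_iff i j).1 h]⟩
      · exact ⟨by simp [(C.c_zero_iff i j).2 h], by simp [h]⟩)
    (fun h => by simp [h]) (fun h => by simp [h]) (fun h => by simp [h])
  apply hF
  simpa only [sword, map_list_prod, List.map_map, Function.comp_def] using key

/-- Matsumoto's theorem: products of elements that satisfy the braid relations along reduced
words depend only on the element of `W`. -/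
theorem prod_eq_of_reduced (hC : C.IsFiniteType) {M : Type*} [Monoid M] (τ : I → M)
    (hτ : ∀ i j, i ≠ j → ((altWord (C.braidOrder i j) i j).map τ).prod
      = ((altWord (C.braidOrder i j) j i).map τ).prod)
    (ω ω' : List I) (h : C.Reduced ω) (h' : C.Reduced ω') (e : C.sword ω = C.sword ω') :
    (ω.map τ).prod = (ω'.map τ).prod := by
  obtain ⟨n, hn⟩ : ∃ n, ω.length = n := ⟨_, rfl⟩
  induction n generalizing ω ω' with
  | zero =>
    have h2 := h' ω e
    rw [List.length_eq_zero_iff.1 hn, List.length_eq_zero_iff.1 (by omega : ω'.length = 0)]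
  | succ n ih =>
    have hlen : ω.length = ω'.length := le_antisymm (h ω' e.symm) (h' ω e)
    have same : ∀ (i : I) (a b : List I), C.Reduced (i :: a) → C.Reduced (i :: b) →
        C.sword (i :: a) = C.sword (i :: b) → a.length = n →
        ((i :: a).map τ).prod = ((i :: b).map τ).prod := by
      intro i a b ha hb hab hl
      rw [List.map_cons, List.map_cons, List.prod_cons, List.prod_cons,
        ih a b ha.of_cons hb.of_cons (mul_left_cancel hab) hl]
    match ω, ω', h, h', e, hn, hlen with
    | i :: a, j :: b, h, h', e, hn, hlen =>
      simp only [List.length_cons, Nat.add_right_cancel_iff] at hn hlen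
      by_cases hij : i = j
      · subst hij
        exact same i a b h h' e hn
      obtain ⟨ω₂, h1, h2⟩ := exists_altWord_append hC hij (i :: a) (h.not_nonneg_of_cons hC)
        (by rw [e]; exact h'.not_nonneg_of_cons hC) _ le_rfl
      obtain ⟨m, hm⟩ : ∃ m, C.braidOrder i j = m + 1 :=
        Nat.exists_eq_succ_of_ne_zero (by unfold braidOrder; split_ifs <;> simp)
      have hbr := hτ i j hij
      have hbs := sword_braid hC hij
      rw [hm] at h1 h2 hbr hbs
      simp only [List.length_cons] at h2
      have e1 : ((i :: a).map τ).prod = ((altWord (m + 1) i j ++ ω₂).map τ).prod := by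
        refine same i a (altWord m j i ++ ω₂) h ?_ h1.symm hn
        intro ω₃ h3
        have := h ω₃ (h3.trans h1)
        simp only [List.length_cons, List.length_append, length_altWord] at this ⊢
        omega
      have e2 : ((altWord (m + 1) j i ++ ω₂).map τ).prod = ((j :: b).map τ).prod := by
        have h1' : C.sword (altWord (m + 1) j i ++ ω₂) = C.sword (j :: b) := by
          rw [← e, ← h1, sword_append, sword_append, hbs]
        refine same j (altWord m i j ++ ω₂) b ?_ h' h1' ?_
        · intro ω₃ h3
          have := h' ω₃ (h3.trans h1')
          simp only [List.length_cons, List.length_append, length_altWord] at this ⊢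
          omega
        · simp only [List.length_append, length_altWord]
          omega
      rw [e1, ← e2, List.map_append, List.map_append, List.prod_append, List.prod_append, hbr]

end Weyl

/-! ### Inversions and the longest element -/

section Longest

variable {I : Type*} [Fintype I] [DecidableEq I] {C : SymGCM I}

/-- The positive roots, each paired with its coroot. -/
noncomputable def IsFiniteType.posRoots (hC : C.IsFiniteType) : Finset ((I → ℤ) × (I → ℤ)) :=
  (hC.finite_rootPairs.subset (Set.sep_subset _ fun p => 0 ≤ p.1)).toFinset

theorem IsFiniteType.mem_posRoots (hC : C.IsFiniteType) {p : (I → ℤ) × (I → ℤ)} :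
    p ∈ hC.posRoots ↔ C.IsRootPair p.1 p.2 ∧ 0 ≤ p.1 := by
  simp [posRoots]

/-- The simple root `α i` paired with its coroot. -/
def simplePair (C : SymGCM I) (i : I) : (I → ℤ) × (I → ℤ) := (C.simpleRoot i, C.simpleRoot i)

/-- The action of `s i` on pairs of a root and its coroot. -/
def reflPair (C : SymGCM I) (i : I) (p : (I → ℤ) × (I → ℤ)) : (I → ℤ) × (I → ℤ) :=
  (C.reflFun i p.1, C.corootReflFun i p.2)

theorem IsFiniteType.simplePair_mem (hC : C.IsFiniteType) (i : I) :
    C.simplePair i ∈ hC.posRoots :=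
  hC.mem_posRoots.2 ⟨.simple i, simpleRoot_nonneg (C := C) i⟩

theorem reflPair_reflPair (i : I) (p : (I → ℤ) × (I → ℤ)) :
    C.reflPair i (C.reflPair i p) = p :=
  Prod.ext (C.reflFun_reflFun i p.1) (C.corootReflFun_corootReflFun i p.2)

theorem IsFiniteType.reflPair_mem (hC : C.IsFiniteType) {i : I} {p : (I → ℤ) × (I → ℤ)}
    (hp : p ∈ hC.posRoots.erase (C.simplePair i)) :
    C.reflPair i p ∈ hC.posRoots.erase (C.simplePair i) := by
  obtain ⟨hne, hp⟩ := mem_erase.1 hp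
  obtain ⟨hr, h0⟩ := hC.mem_posRoots.1 hp
  have hne1 : p.1 ≠ C.simpleRoot i := by
    intro h
    refine hne (Prod.ext h ?_)
    refine IsRootPair.coroot_unique (C := C) (β := C.simpleRoot i) ?_ (.simple i)
    rw [← h]
    exact hr
  refine mem_erase.2 ⟨fun h => ?_, hC.mem_posRoots.2 ⟨hr.refl i _ _, hr.reflFun_nonneg hC h0 hne1⟩⟩
  have h1 : C.reflFun i p.1 = C.simpleRoot i := congrArg Prod.fst h
  have h2 : p.1 = -C.simpleRoot i := by
    rw [← reflFun_simpleRoot, ← h1, reflFun_reflFun]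
  exact hr.not_nonneg_of_nonpos (h2 ▸ neg_nonpos.2 (simpleRoot_nonneg i)) h0

theorem IsFiniteType.sum_erase_reflPair (hC : C.IsFiniteType) {A : Type*} [AddCommMonoid A] (i : I)
    (F : (I → ℤ) × (I → ℤ) → A) :
    ∑ p ∈ hC.posRoots.erase (C.simplePair i), F (C.reflPair i p)
      = ∑ p ∈ hC.posRoots.erase (C.simplePair i), F p :=
  sum_nbij' (C.reflPair i) (C.reflPair i) (fun _ h => hC.reflPair_mem h)
    (fun _ h => hC.reflPair_mem h) (fun p _ => reflPair_reflPair i p)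
    (fun p _ => reflPair_reflPair i p) fun _ _ => rfl

/-- The sum of the weights `f` of the inversions of `w`, the positive roots made negative by
`w⁻¹`. -/
noncomputable def IsFiniteType.invSum (hC : C.IsFiniteType) (f : (I → ℤ) × (I → ℤ) → ℤ)
    (w : (I → ℤ) ≃ₗ[ℤ] (I → ℤ)) : ℤ :=
  open Classical in ∑ p ∈ hC.posRoots, if 0 ≤ w⁻¹ p.1 then 0 else f p

theorem IsFiniteType.invSum_s_mul (hC : C.IsFiniteType) {f : (I → ℤ) × (I → ℤ) → ℤ}
    (hf : ∀ i p, f (C.reflPair i p) = f p) {w : (I → ℤ) ≃ₗ[ℤ] (I → ℤ)} (hw : w ∈ C.weylGroup)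
    {i : I} (hi : 0 ≤ w⁻¹ (C.simpleRoot i)) :
    hC.invSum f (C.s i * w) = hC.invSum f w + f (C.simplePair i) := by
  classical
  have hneg : ¬ 0 ≤ (C.s i * w)⁻¹ (C.simpleRoot i) := by
    obtain ⟨γ, hγ⟩ := (IsRootPair.simple (C := C) i).weyl_apply (inv_mem hw)
    rw [mul_inv_rev, s_inv, LinearEquiv.mul_apply, s_apply, reflFun_simpleRoot, map_neg]
    exact hγ.neg.not_nonneg_of_nonpos (neg_nonpos.2 hi)
  rw [invSum, invSum, ← sum_erase_add _ _ (hC.simplePair_mem i),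
    ← sum_erase_add _ _ (hC.simplePair_mem i), ← hC.sum_erase_reflPair]
  rw [if_neg (show ¬ 0 ≤ (C.s i * w)⁻¹ (C.simplePair i).1 from hneg),
    if_pos (show 0 ≤ w⁻¹ (C.simplePair i).1 from hi), add_zero]
  congr 1
  refine sum_congr rfl fun p _ => ?_
  have : (C.s i * w)⁻¹ (C.reflPair i p).1 = w⁻¹ p.1 := by
    rw [mul_inv_rev, s_inv, LinearEquiv.mul_apply, s_apply, reflPair, reflFun_reflFun]
  rw [this, hf]

/-- The letters of a reduced word for `w` correspond to the inversions of `w`. -/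
theorem IsFiniteType.invSum_sword (hC : C.IsFiniteType) {f : (I → ℤ) × (I → ℤ) → ℤ}
    (hf : ∀ i p, f (C.reflPair i p) = f p) {ω : List I} (h : C.Reduced ω) :
    hC.invSum f (C.sword ω) = (ω.map fun i => f (C.simplePair i)).sum := by
  induction ω with
  | nil =>
    refine sum_eq_zero fun p hp => ?_
    exact if_pos (hC.mem_posRoots.1 hp).2
  | cons i ω ih =>
    rw [sword_cons, hC.invSum_s_mul hf (sword_mem ω) (h.nonneg_of_cons hC), ih h.of_cons,
      List.map_cons, List.sum_cons, add_comm]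

theorem IsFiniteType.len_eq (hC : C.IsFiniteType) (w : C.weylGroup) :
    (C.len w : ℤ) = hC.invSum (fun _ => 1) w := by
  obtain ⟨ω, hω⟩ := C.exists_reducedWord w
  rw [← hω.2, ← hω.1, hC.invSum_sword (fun _ _ => rfl) (isReducedWord_iff.1 hω).2]
  simp

theorem IsFiniteType.len_le_len_w₀ (hC : C.IsFiniteType) (w : C.weylGroup) :
    C.len w ≤ C.len C.w₀ := by
  classical
  have hb : ∀ w : C.weylGroup, C.len w ≤ hC.posRoots.card := by
    intro w
    have : (C.len w : ℤ) ≤ hC.posRoots.card := by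
      rw [hC.len_eq, invSum, card_eq_sum_ones, Nat.cast_sum]
      exact sum_le_sum fun p _ => by split_ifs <;> simp
    exact_mod_cast this
  have hex : ∃ w : C.weylGroup, ∀ w', C.len w' ≤ C.len w := by
    have hfin : (Set.range C.len).Finite :=
      (Set.finite_Iic hC.posRoots.card).subset (by rintro _ ⟨w, rfl⟩; exact hb w)
    obtain ⟨_, ⟨w, rfl⟩, hm⟩ := hfin.exists_maximal ⟨_, 1, rfl⟩
    refine ⟨w, fun w' => ?_⟩
    rcases le_total (C.len w') (C.len w) with h | h
    · exact h
    · exact hm ⟨w', rfl⟩ h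
  exact Classical.epsilon_spec hex w

/-- The longest element as an automorphism of the root lattice. -/
noncomputable abbrev longest (C : SymGCM I) : (I → ℤ) ≃ₗ[ℤ] (I → ℤ) := C.w₀

theorem longest_mem : C.longest ∈ C.weylGroup := C.w₀.2

theorem IsFiniteType.longest_inv_simpleRoot (hC : C.IsFiniteType) (i : I) :
    C.longest⁻¹ (C.simpleRoot i) ≤ 0 := by
  obtain ⟨γ, hγ⟩ := (IsRootPair.simple (C := C) i).weyl_apply (inv_mem C.longest_mem)
  refine hγ.nonpos_of_not_nonneg hC fun hn => ?_
  have h1 := hC.invSum_s_mul (f := fun _ => 1) (fun _ _ => rfl) C.longest_mem hn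
  have h2 := hC.len_le_len_w₀ ⟨C.s i * C.longest,
    mul_mem (Subgroup.subset_closure ⟨i, rfl⟩) C.longest_mem⟩
  have h3 := hC.len_eq ⟨C.s i * C.longest,
    mul_mem (Subgroup.subset_closure ⟨i, rfl⟩) C.longest_mem⟩
  have h4 := hC.len_eq C.w₀
  simp only at h3
  change hC.invSum _ _ = hC.invSum _ (C.w₀ : (I → ℤ) ≃ₗ[ℤ] (I → ℤ)) + 1 at h1
  omega

theorem eq_sum_simpleRoot (C : SymGCM I) (x : I → ℤ) : x = ∑ i, x i • C.simpleRoot i := by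
  funext j
  simp [simpleRoot, Pi.single_apply]

theorem IsFiniteType.longest_inv_nonpos (hC : C.IsFiniteType) {x : I → ℤ} (hx : 0 ≤ x) :
    C.longest⁻¹ x ≤ 0 := by
  rw [C.eq_sum_simpleRoot x, map_sum]
  refine sum_nonpos fun i _ => ?_
  rw [map_smul]
  exact smul_nonpos_of_nonneg_of_nonpos (hx i) (hC.longest_inv_simpleRoot i)

theorem IsRootPair.longest_nonpos (hC : C.IsFiniteType) {β γ : I → ℤ} (h : C.IsRootPair β γ)
    (hβ : 0 ≤ β) : C.longest β ≤ 0 := by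
  obtain ⟨γ', hγ⟩ := h.weyl_apply C.longest_mem
  refine hγ.nonpos_of_not_nonneg hC fun hn => ?_
  have := hC.longest_inv_nonpos hn
  rw [← LinearEquiv.mul_apply, inv_mul_cancel] at this
  exact h.not_nonneg_of_nonpos this hβ

/-- Every positive root is an inversion of the longest element. -/
theorem IsFiniteType.invSum_longest (hC : C.IsFiniteType) (f : (I → ℤ) × (I → ℤ) → ℤ) :
    hC.invSum f C.longest = ∑ p ∈ hC.posRoots, f p := by
  refine sum_congr rfl fun p hp => if_neg ?_
  obtain ⟨hr, h0⟩ := hC.mem_posRoots.1 hp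
  obtain ⟨γ', hγ⟩ := hr.weyl_apply (inv_mem C.longest_mem)
  exact hγ.not_nonneg_of_nonpos (hC.longest_inv_nonpos h0)

theorem IsRootPair.one_le_height {β γ : I → ℤ} (h : C.IsRootPair β γ) (hβ : 0 ≤ β) :
    1 ≤ ∑ i, β i := by
  have h0 : 0 ≤ ∑ i, β i := sum_nonneg fun i _ => hβ i
  rcases h0.eq_or_lt with h1 | h1
  · refine absurd (funext fun i => ?_) h.ne_zero
    exact (sum_eq_zero_iff_of_nonneg fun i _ => hβ i).1 h1.symm i (mem_univ i)
  · exact h1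

/-- The longest element permutes the simple roots up to sign: the matrices of `- w₀` and of
`- w₀⁻¹` have nonnegative entries, so comparing heights in `α i = (- w₀⁻¹) ((- w₀) (α i))` shows
that `- w₀ (α i)` involves a single simple root. -/
theorem IsFiniteType.longest_simpleRoot (hC : C.IsFiniteType) (i : I) :
    C.longest (C.simpleRoot i) = -C.simpleRoot (C.star i) := by
  have hex : ∃ k, (C.w₀ : (I → ℤ) ≃ₗ[ℤ] (I → ℤ)) (C.simpleRoot i) = -C.simpleRoot k := by
    obtain ⟨n, hn⟩ : ∃ n, n = -C.longest (C.simpleRoot i) := ⟨_, rfl⟩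
    obtain ⟨γ, hγ⟩ := (IsRootPair.simple (C := C) i).weyl_apply C.longest_mem
    have hn0 : 0 ≤ n := by
      rw [hn]
      exact neg_nonneg.2 ((IsRootPair.simple i).longest_nonpos hC (simpleRoot_nonneg i))
    have e : C.simpleRoot i = ∑ j, n j • -(C.longest⁻¹ (C.simpleRoot j)) := by
      have : C.longest⁻¹ (-n) = C.simpleRoot i := by
        rw [hn, neg_neg, ← LinearEquiv.mul_apply, inv_mul_cancel]
        rfl
      rw [← this, map_neg]
      conv_lhs => rw [C.eq_sum_simpleRoot n, map_sum]
      rw [← sum_neg_distrib]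
      exact sum_congr rfl fun j _ => by rw [map_smul, smul_neg]
    have hh : (1 : ℤ) = ∑ j, n j * ∑ k, (-(C.longest⁻¹ (C.simpleRoot j))) k := by
      have h1 : ∑ k, C.simpleRoot i k = 1 := by simp [simpleRoot, Pi.single_apply]
      rw [← h1]
      conv_lhs => rw [e]
      simp only [Finset.sum_apply, Pi.smul_apply, smul_eq_mul, mul_sum]
      exact sum_comm
    have hge : ∀ j, n j ≤ n j * ∑ k, (-(C.longest⁻¹ (C.simpleRoot j))) k := by
      intro j
      obtain ⟨γ', hγ'⟩ := (IsRootPair.simple (C := C) j).weyl_apply (inv_mem C.longest_mem)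
      have := hγ'.neg.one_le_height
        (neg_nonneg.2 (hC.longest_inv_simpleRoot j))
      exact le_mul_of_one_le_right (hn0 j) this
    have hle : ∑ j, n j ≤ 1 := by
      rw [hh]
      exact sum_le_sum fun j _ => hge j
    have hne : n ≠ 0 := by
      rw [hn]
      exact hγ.neg.ne_zero
    obtain ⟨k, hk⟩ : ∃ k, n k ≠ 0 := by
      by_contra! hcon
      exact hne (funext hcon)
    have hk1 : 1 ≤ n k := by
      have : 0 ≤ n k := hn0 k
      omega
    have hsplit := add_sum_erase univ n (mem_univ k)
    have hrest : 0 ≤ ∑ j ∈ univ.erase k, n j := sum_nonneg fun j _ => hn0 j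
    have hrest0 : ∑ j ∈ univ.erase k, n j = 0 := by omega
    refine ⟨k, ?_⟩
    rw [← neg_eq_iff_eq_neg]
    change -C.longest (C.simpleRoot i) = _
    rw [← hn]
    funext j
    by_cases hj : j = k
    · subst hj
      simp only [simpleRoot, Pi.single_eq_same]
      omega
    · have := (sum_eq_zero_iff_of_nonneg fun j _ => hn0 j).1 hrest0 j
        (mem_erase.2 ⟨hj, mem_univ j⟩)
      simp [simpleRoot, hj, this]
  have : Nonempty I := ⟨i⟩
  exact Classical.epsilon_spec hex

theorem simpleRoot_injective (C : SymGCM I) : Function.Injective C.simpleRoot := by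
  intro i j h
  by_contra hij
  have := congrFun h i
  simp [simpleRoot, hij] at this

/-- The longest element is an involution, as its square has no inversions. -/
theorem IsFiniteType.longest_mul_longest (hC : C.IsFiniteType) :
    C.longest * C.longest = 1 := by
  obtain ⟨ω, h1, h2⟩ := C.exists_reducedWord (C.w₀ * C.w₀)
  have h3 := (isReducedWord_iff.1 ⟨h1, h2⟩).2
  have h4 : C.sword ω = C.longest * C.longest := h1
  cases ω with
  | nil => exact h4.symm
  | cons i ω =>
    refine absurd ?_ (h3.not_nonneg_of_cons hC)
    rw [h4, mul_inv_rev, LinearEquiv.mul_apply]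
    have := hC.longest_inv_nonpos
      (neg_nonneg.2 (hC.longest_inv_simpleRoot i))
    rw [map_neg] at this
    exact neg_nonpos.1 this

theorem IsFiniteType.star_star (hC : C.IsFiniteType) (i : I) : C.star (C.star i) = i := by
  apply C.simpleRoot_injective
  have h := hC.longest_simpleRoot (C.star i)
  have h2 := LinearEquiv.congr_fun hC.longest_mul_longest (C.simpleRoot i)
  rw [LinearEquiv.mul_apply, hC.longest_simpleRoot i, map_neg, h, neg_neg] at h2
  exact h2

theorem IsFiniteType.d_star (hC : C.IsFiniteType) (i : I) : C.d (C.star i) = C.d i := by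
  refine (d_eq_of_weyl_apply C.longest_mem (e := -1) (by norm_num) ?_).symm
  rw [hC.longest_simpleRoot, neg_one_smul]

theorem IsFiniteType.c_star (hC : C.IsFiniteType) (i j : I) :
    C.c (C.star i) (C.star j) = C.c i j := by
  have h := sform_weyl C.longest_mem (C.simpleRoot i) (C.simpleRoot j)
  rw [hC.longest_simpleRoot, hC.longest_simpleRoot] at h
  simp only [map_neg, LinearMap.neg_apply, neg_neg, sform_simpleRoot_left,
    pairing_simpleRoot_simpleRoot, hC.d_star] at h
  have hd0 : (C.d i : ℤ) ≠ 0 := by exact_mod_cast (C.d_pos i).ne'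
  exact mul_left_cancel₀ hd0 h

/-- If the `τ i` satisfy the braid relations, then the product `τ_{w₀}` along a reduced word of
the longest element intertwines `τ i` and `τ (i^*)`. -/
theorem IsFiniteType.intertwine (hC : C.IsFiniteType) {M : Type*} [Monoid M] (τ : I → M)
    (hτ : ∀ i j, i ≠ j → ((altWord (C.braidOrder i j) i j).map τ).prod
      = ((altWord (C.braidOrder i j) j i).map τ).prod)
    {ω : List I} (hω : C.IsReducedWord ω C.w₀) (i : I) :
    τ (C.star i) * (ω.map τ).prod = (ω.map τ).prod * τ i := by
  obtain ⟨h1, hred⟩ := isReducedWord_iff.1 hω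
  have hinv : ¬ 0 ≤ (C.sword ω)⁻¹ (C.simpleRoot (C.star i)) := by
    have : (C.sword ω)⁻¹ (C.simpleRoot (C.star i)) = -C.simpleRoot i := by
      rw [h1]
      have h2 := hC.longest_simpleRoot i
      rw [eq_neg_iff_add_eq_zero, ← eq_neg_iff_add_eq_zero, eq_comm, neg_eq_iff_eq_neg] at h2
      rw [h2, map_neg, ← LinearEquiv.mul_apply, inv_mul_cancel]
      rfl
    rw [this]
    exact (IsRootPair.simple i).neg.not_nonneg_of_nonpos (neg_nonpos.2 (simpleRoot_nonneg i))
  obtain ⟨ω', h2, h3⟩ := exists_word_of_not_nonneg hC _ ω hinv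
  have h4 : C.sword (C.star i :: ω') = C.sword ω := by
    rw [sword_cons, h2, ← mul_assoc, s_mul_s, one_mul]
  have h5 : C.sword (ω' ++ [i]) = C.sword ω := by
    have h6 : C.longest * C.s i = C.s (C.star i) * C.longest :=
      weyl_mul_s C.longest_mem (e := -1) (by norm_num)
        (by rw [hC.longest_simpleRoot, neg_one_smul])
    rw [sword_append, h2, h1, ← h6]
    simp [mul_assoc, s_mul_s]
  have key : ∀ ω₂, C.sword ω₂ = C.sword ω → ω₂.length = ω.length →
      (ω₂.map τ).prod = (ω.map τ).prod := by
    intro ω₂ e l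
    refine prod_eq_of_reduced hC τ hτ ω₂ ω (fun ω₃ h => ?_) hred e
    rw [l]
    exact hred ω₃ (h.trans e)
  have k1 := key _ h4 (by simp [h3])
  have k2 := key _ h5 (by simp [h3])
  simp only [List.map_cons, List.prod_cons] at k1
  simp only [List.map_append, List.prod_append, List.map_cons, List.map_nil, List.prod_cons,
    List.prod_nil, mul_one] at k2
  calc τ (C.star i) * (ω.map τ).prod = τ (C.star i) * ((ω'.map τ).prod * τ i) := by rw [k2]
    _ = (ω.map τ).prod * τ i := by rw [← mul_assoc, k1]

end Longest

/-! ### The highest root -/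

section Highest

variable {I : Type*} [Fintype I] [DecidableEq I] {C : SymGCM I}

/-- `x` is dominant: its pairings with all simple coroots are nonnegative. -/
def Dominant (C : SymGCM I) (x : I → ℤ) : Prop := ∀ i, 0 ≤ C.pairing x (C.simpleRoot i)

theorem dominant_of_maximal {x : I → ℤ} (h : ∀ i, x ≤ C.reflFun i x → C.reflFun i x ≤ x) :
    C.Dominant x := by
  intro i
  by_contra! hn
  have h1 : x ≤ C.reflFun i x := by
    rw [reflFun_eq, sub_eq_add_neg, ← neg_smul]
    exact le_add_of_nonneg_right (smul_nonneg (by omega) (simpleRoot_nonneg i))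
  have h2 := h i h1 i
  rw [reflFun_eq] at h2
  simp only [simpleRoot, Pi.sub_apply, Pi.smul_apply, Pi.single_eq_same, smul_eq_mul,
    mul_one] at h2
  simp only [simpleRoot] at hn
  omega

theorem sform_eq_sum (x y : I → ℤ) :
    C.sform x y = ∑ i, x i * (C.d i * C.pairing y (C.simpleRoot i)) := by
  conv_lhs => rw [C.eq_sum_simpleRoot x]
  rw [map_sum, LinearMap.sum_apply]
  refine sum_congr rfl fun i _ => ?_
  rw [map_smul, LinearMap.smul_apply, smul_eq_mul, sform_simpleRoot_left]

theorem Dominant.sform_nonneg {x y : I → ℤ} (hx : C.Dominant x) (hy : 0 ≤ y) :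
    0 ≤ C.sform y x := by
  rw [sform_eq_sum]
  exact sum_nonneg fun i _ => mul_nonneg (hy i) (mul_nonneg (by positivity) (hx i))

theorem Dominant.sform_pos (hC : C.IsFiniteType) {x y : I → ℤ} (hx : C.Dominant x) (hx0 : x ≠ 0)
    (hy : ∀ i, 0 < y i) : 0 < C.sform y x := by
  rw [sform_eq_sum]
  refine sum_pos' (fun i _ => mul_nonneg (hy i).le (mul_nonneg (by positivity) (hx i))) ?_
  by_contra! hcon
  have h0 : ∀ i, C.d i * C.pairing x (C.simpleRoot i) = 0 := by
    intro i
    have h1 := hcon i (mem_univ i)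
    have h2 : 0 ≤ (C.d i : ℤ) * C.pairing x (C.simpleRoot i) :=
      mul_nonneg (by positivity) (hx i)
    exact le_antisymm (nonpos_of_mul_nonpos_right h1 (hy i)) h2
  have := hC.sform_pos hx0
  rw [sform_eq_sum] at this
  simp [h0] at this

theorem Dominant.nonneg (hC : C.IsFiniteType) {β γ : I → ℤ} (hβ : C.IsRootPair β γ)
    (h : C.Dominant β) : 0 ≤ β := by
  by_contra hn
  have h1 := h.sform_nonneg (neg_nonneg.2 (hβ.nonpos_of_not_nonneg hC hn))
  rw [map_neg, LinearMap.neg_apply] at h1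
  have := hβ.sform_self_pos
  omega

/-- A nonzero dominant vector with nonnegative coefficients has full support when the Cartan
matrix is irreducible. -/
theorem Dominant.pos (hirr : C.Irreducible) {x : I → ℤ} (h : C.Dominant x) (hx : 0 ≤ x)
    (hx0 : x ≠ 0) (j : I) : 0 < x j := by
  have step : ∀ a b, C.graph.Adj a b → 0 < x a → 0 < x b := by
    intro a b hab ha
    by_contra hb
    have hb0 : x b = 0 := le_antisymm (not_lt.1 hb) (hx b)
    have h1 := h b
    rw [pairing_simpleRoot_right] at h1
    have h2 : ∑ k, C.c b k * x k < 0 := by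
      refine sum_neg' (fun k _ => ?_) ⟨a, mem_univ a, ?_⟩
      · by_cases hk : b = k
        · rw [← hk, hb0, mul_zero]
        · exact mul_nonpos_of_nonpos_of_nonneg (C.c_nonpos b k hk) (hx k)
      · exact mul_neg_of_neg_of_pos (C.c_neg_symm hab) ha
    omega
  have hwalk : ∀ {a b : I} (_ : C.graph.Walk a b), 0 < x a → 0 < x b := by
    intro a b p
    induction p with
    | nil => exact id
    | cons hadj _ ih => exact fun ha => ih (step _ _ hadj ha)
  obtain ⟨i, hi⟩ : ∃ i, x i ≠ 0 := by
    by_contra! hcon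
    exact hx0 (funext hcon)
  obtain ⟨p⟩ := hirr i j
  exact hwalk p (lt_of_le_of_ne (hx i) hi.symm)

/-- `θ` is the highest root, with coroot `θv`. -/
def IsHighest (C : SymGCM I) (θ θv : I → ℤ) : Prop :=
  C.IsRootPair θ θv ∧ ∀ β γ, C.IsRootPair β γ → β ≤ θ

theorem IsFiniteType.finite_roots (hC : C.IsFiniteType) :
    {β : I → ℤ | ∃ γ, C.IsRootPair β γ}.Finite := by
  refine (hC.finite_rootPairs.image Prod.fst).subset ?_
  rintro β ⟨γ, h⟩
  exact ⟨(β, γ), h, rfl⟩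

/-- There is a unique maximal root: two maximal roots `θ`, `θ'` are dominant with full support, so
`(θ, θ') > 0`, and then either `θ - θ'` is a root, whence `θ` and `θ'` are comparable, or the two
pairings are at least `2`, which forces `(θ - θ', θ - θ') ≤ 0`. -/
theorem IsFiniteType.isHighest_highestRootPair (hC : C.IsFiniteType) (hirr : C.Irreducible)
    [Nonempty I] : C.IsHighest C.highestRootPair.1 C.highestRootPair.2 := by
  have hdom : ∀ θ, Maximal (fun β => ∃ γ, C.IsRootPair β γ) θ → C.Dominant θ := by
    rintro θ ⟨⟨θv, hθ⟩, hmax⟩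
    exact dominant_of_maximal fun i h => hmax ⟨_, hθ.refl i _ _⟩ h
  have huniq : ∀ θ θ', Maximal (fun β => ∃ γ, C.IsRootPair β γ) θ →
      Maximal (fun β => ∃ γ, C.IsRootPair β γ) θ' → θ = θ' := by
    intro θ θ' h h'
    have d1 := hdom θ h
    have d2 := hdom θ' h'
    obtain ⟨⟨γ, hγ⟩, hm⟩ := h
    obtain ⟨⟨γ', hγ'⟩, hm'⟩ := h'
    have hpos := d2.pos hirr (d2.nonneg hC hγ') hγ'.ne_zero
    have hs := d1.sform_pos hC hγ.ne_zero hpos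
    have hcmp : ∀ ε, C.IsRootPair (θ - θ') ε → θ = θ' := by
      intro ε hε
      rcases hε.nonneg_or_nonpos hC with h0 | h0
      · have := sub_nonneg.1 h0
        exact le_antisymm (hm' ⟨γ, hγ⟩ this) this
      · have := sub_nonpos.1 h0
        exact le_antisymm this (hm ⟨γ', hγ'⟩ this)
    have k1 := hγ'.sform_mul_pairing θ
    have k2 := hγ.sform_mul_pairing θ'
    rw [C.sform_comm θ θ'] at k2
    have p1 : 0 < C.pairing θ γ' := by
      refine (mul_pos_iff_of_pos_left hγ'.sform_self_pos).1 ?_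
      omega
    have p2 : 0 < C.pairing θ' γ := by
      refine (mul_pos_iff_of_pos_left hγ.sform_self_pos).1 ?_
      omega
    by_cases e1 : C.pairing θ γ' = 1
    · have := hγ'.reflect hγ
      rw [e1, one_smul] at this
      exact hcmp _ this
    by_cases e2 : C.pairing θ' γ = 1
    · have := (hγ.reflect hγ').neg
      rw [e2, one_smul, neg_sub] at this
      exact hcmp _ this
    by_contra hne
    have hp := hC.sform_pos (sub_ne_zero.2 hne)
    simp only [map_sub, LinearMap.sub_apply, C.sform_comm θ θ'] at hp
    have q1 := hγ.sform_self_pos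
    have q2 := hγ'.sform_self_pos
    have p1' : 2 ≤ C.pairing θ γ' := by omega
    have p2' : 2 ≤ C.pairing θ' γ := by omega
    nlinarith
  obtain ⟨i⟩ := ‹Nonempty I›
  obtain ⟨θ, -, hθ⟩ := hC.finite_roots.exists_le_maximal
    (show C.simpleRoot i ∈ {β : I → ℤ | ∃ γ, C.IsRootPair β γ} from ⟨_, .simple i⟩)
  have hex : ∃ p : (I → ℤ) × (I → ℤ), C.IsRootPair p.1 p.2 ∧
      ∀ β γ, C.IsRootPair β γ → β ≤ p.1 := by
    obtain ⟨θv, hv⟩ := hθ.1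
    refine ⟨(θ, θv), hv, fun β γ h => ?_⟩
    obtain ⟨θ', hle, hθ'⟩ := hC.finite_roots.exists_le_maximal
      (show β ∈ {β : I → ℤ | ∃ γ, C.IsRootPair β γ} from ⟨γ, h⟩)
    rw [huniq θ θ' hθ hθ']
    exact hle
  exact Classical.epsilon_spec hex

namespace IsHighest

variable {θ θv : I → ℤ}

theorem dominant (h : C.IsHighest θ θv) : C.Dominant θ :=
  dominant_of_maximal fun i _ => h.2 _ _ (h.1.refl i _ _)

theorem pos (hC : C.IsFiniteType) (hirr : C.Irreducible) (h : C.IsHighest θ θv) (i : I) :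
    0 < θ i :=
  h.dominant.pos hirr (h.dominant.nonneg hC h.1) h.1.ne_zero i

theorem pairing_nonneg (h : C.IsHighest θ θv) {β : I → ℤ} (hβ : 0 ≤ β) :
    0 ≤ C.pairing β θv := by
  have h1 := h.1.sform_mul_pairing β
  have h2 := h.dominant.sform_nonneg hβ
  rw [C.sform_comm] at h2
  refine (mul_nonneg_iff_of_pos_left h.1.sform_self_pos).1 ?_
  omega

/-- A positive root other than the highest root `θ` pairs to at most `1` with `θ^∨`: otherwise its
reflection in `θ` would be a root that is not bounded below by `- θ`. -/
theorem pairing_le_one (hC : C.IsFiniteType) (hirr : C.Irreducible)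
    (h : C.IsHighest θ θv) {β γ : I → ℤ} (hβ : C.IsRootPair β γ) (hne : β ≠ θ) :
    C.pairing β θv ≤ 1 := by
  by_contra! hcon
  have h1 := (h.1.reflect hβ).neg
  have h2 := h.2 _ _ h1
  have h3 := h.2 _ _ hβ
  refine hne (le_antisymm h3 fun i => ?_)
  have h4 := h2 i
  have h5 := h3 i
  have h6 := h.pos hC hirr i
  simp only [Pi.neg_apply, Pi.sub_apply, Pi.smul_apply, smul_eq_mul] at h4
  nlinarith

/-- The highest root is long and its square length is `2 r`. -/
theorem sform_self (hC : C.IsFiniteType) (hirr : C.Irreducible)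
    (h : C.IsHighest θ θv) : C.sform θ θ = 2 * C.r := by
  obtain ⟨k, hk⟩ := h.1.coroot_eq.2.1
  have hdvd : ∀ i, C.d i ∣ C.d k := by
    intro i
    -- A maximal root in the orbit of `α i` is dominant, hence not orthogonal to `θ`.
    have hfin : {δ : I → ℤ | ∃ w ∈ C.weylGroup, δ = w (C.simpleRoot i)}.Finite := by
      refine hC.finite_roots.subset ?_
      rintro _ ⟨w, hw, rfl⟩
      exact (IsRootPair.simple i).weyl_apply hw
    obtain ⟨δ, -, ⟨w, hw, hδ⟩, hmax⟩ := hfin.exists_le_maximal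
      (show C.simpleRoot i ∈ {δ : I → ℤ | ∃ w ∈ C.weylGroup, δ = w (C.simpleRoot i)} from
        ⟨1, one_mem _, rfl⟩)
    have hdom : C.Dominant δ := dominant_of_maximal fun j hj =>
      hmax ⟨C.s j * w, mul_mem (Subgroup.subset_closure ⟨j, rfl⟩) hw, by rw [hδ]; rfl⟩ hj
    obtain ⟨ε, hε⟩ := (IsRootPair.simple (C := C) i).weyl_apply hw
    rw [← hδ] at hε
    have hlen : C.sform δ δ = 2 * C.d i := by
      rw [hδ, sform_weyl hw, sform_simpleRoot_self]
    have e1 := h.1.sform_mul_pairing δ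
    have e2 := hε.sform_mul_pairing θ
    rw [C.sform_comm δ θ] at e2
    have hdvd : (C.d i : ℤ) ∣ C.d k := by
      by_cases hne : δ = θ
      · rw [hne] at hlen
        exact ⟨1, by omega⟩
      · have hp := hdom.sform_pos hC hε.ne_zero (h.pos hC hirr)
        have h1 := h.pairing_le_one hC hirr hε hne
        have h2 : 0 < C.pairing δ θv := by
          refine (mul_pos_iff_of_pos_left h.1.sform_self_pos).1 ?_
          omega
        have h3 : C.pairing δ θv = 1 := by omega
        rw [h3, hk] at e1
        rw [hlen] at e2
        exact ⟨C.pairing θ ε, by linarith⟩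
    exact_mod_cast hdvd
  have hr : C.r = C.d k :=
    Nat.dvd_antisymm (lcm_dvd fun i _ => hdvd i) (dvd_lcm (mem_univ k))
  rw [hk, hr]

end IsHighest

end Highest

/-! ### Casimir sums over the positive roots -/

section Casimir

variable {I : Type*} [Fintype I] [DecidableEq I] {C : SymGCM I}

/-- The endomorphism `x ↦ ∑ g(β) ⟨x, β^∨⟩ β` of the root lattice, the sum being over the positive
roots `β`. -/
noncomputable def IsFiniteType.casimir (hC : C.IsFiniteType) (g : (I → ℤ) × (I → ℤ) → ℤ) :
    (I → ℤ) →ₗ[ℤ] (I → ℤ) :=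
  ∑ p ∈ hC.posRoots, (g p • C.pairing.flip p.2).smulRight p.1

theorem IsFiniteType.casimir_apply (hC : C.IsFiniteType) (g : (I → ℤ) × (I → ℤ) → ℤ)
    (x : I → ℤ) : hC.casimir g x = ∑ p ∈ hC.posRoots, (g p * C.pairing x p.2) • p.1 := by
  simp [casimir, LinearMap.sum_apply]

theorem IsFiniteType.casimir_reflFun (hC : C.IsFiniteType) {g : (I → ℤ) × (I → ℤ) → ℤ}
    (hg : ∀ i p, g (C.reflPair i p) = g p) (i : I) (x : I → ℤ) :
    hC.casimir g (C.reflFun i x) = C.reflFun i (hC.casimir g x) := by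
  rw [← s_apply i (hC.casimir g x), hC.casimir_apply, hC.casimir_apply, map_sum,
    ← sum_erase_add _ _ (hC.simplePair_mem i), ← sum_erase_add _ _ (hC.simplePair_mem i),
    ← hC.sum_erase_reflPair]
  congr 1
  · refine sum_congr rfl fun p _ => ?_
    rw [hg, map_smul, s_apply, reflPair, pairing_reflFun, corootReflFun_corootReflFun]
  · rw [map_smul, s_apply]
    simp only [simplePair]
    rw [reflFun_simpleRoot, pairing_reflFun, corootReflFun_eq, pairing_simpleRoot_simpleRoot,
      C.c_self]
    simp only [map_sub, map_smul, smul_eq_mul]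
    module

/-- The endomorphism `casimir g` commutes with `W`, hence is a scalar. -/
theorem IsFiniteType.exists_casimir_eq_smul (hC : C.IsFiniteType) (hirr : C.Irreducible)
    [Nonempty I] {g : (I → ℤ) × (I → ℤ) → ℤ} (hg : ∀ i p, g (C.reflPair i p) = g p) :
    ∃ κ : ℤ, ∀ x, hC.casimir g x = κ • x := by
  have h1 : ∀ i, hC.casimir g (C.simpleRoot i)
      = (hC.casimir g (C.simpleRoot i) i) • C.simpleRoot i := by
    intro i
    have e := hC.casimir_reflFun hg i (C.simpleRoot i)
    rw [reflFun_simpleRoot, map_neg, reflFun_eq] at e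
    funext j
    by_cases hj : j = i
    · subst hj
      simp [simpleRoot]
    · have := congrFun e j
      simp only [simpleRoot, Pi.neg_apply, Pi.sub_apply, Pi.smul_apply, Pi.single_apply, hj,
        if_false, smul_zero, sub_zero] at this ⊢
      omega
  set κ : I → ℤ := fun i => hC.casimir g (C.simpleRoot i) i with hκ
  have hadj : ∀ i j, C.graph.Adj i j → κ i = κ j := by
    intro i j hij
    have hne : i ≠ j := C.graph.ne_of_adj hij
    have e := hC.casimir_reflFun hg j (C.simpleRoot i)
    rw [h1 i, reflFun_eq, reflFun_eq, map_sub, map_smul, h1 i, h1 j, map_smul,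
      LinearMap.smul_apply, pairing_simpleRoot_simpleRoot] at e
    have e2 := congrFun e j
    simp only [simpleRoot, Pi.sub_apply, Pi.smul_apply, Pi.single_eq_same, smul_eq_mul,
      Pi.single_eq_of_ne hne.symm, mul_zero, mul_one, zero_sub, neg_inj] at e2
    have hc : C.c j i ≠ 0 := (C.c_neg_symm hij).ne
    refine mul_left_cancel₀ hc ?_
    rw [mul_comm]
    exact e2.symm
  have hwalk : ∀ {a b : I} (_ : C.graph.Walk a b), κ a = κ b := by
    intro a b p
    induction p with
    | nil => rfl
    | cons h _ ih => rw [hadj _ _ h, ih]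
  obtain ⟨o⟩ := ‹Nonempty I›
  refine ⟨κ o, fun x => ?_⟩
  conv_lhs => rw [C.eq_sum_simpleRoot x, map_sum]
  conv_rhs => rw [C.eq_sum_simpleRoot x, smul_sum]
  refine sum_congr rfl fun i _ => ?_
  obtain ⟨p⟩ := hirr o i
  rw [map_smul, h1 i, hwalk p, smul_comm]

theorem IsFiniteType.two_mul_sum_eq (hC : C.IsFiniteType) {g : (I → ℤ) × (I → ℤ) → ℤ} {κ : ℤ}
    (h : ∀ x, hC.casimir g x = κ • x) :
    2 * ∑ p ∈ hC.posRoots, g p = Fintype.card I * κ := by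
  -- Both sides are the trace.
  have h1 : ∑ i, hC.casimir g (C.simpleRoot i) i = Fintype.card I * κ := by
    simp [h, simpleRoot]
  rw [← h1]
  simp only [hC.casimir_apply, Finset.sum_apply, Pi.smul_apply, smul_eq_mul]
  rw [sum_comm, mul_sum]
  refine sum_congr rfl fun p hp => ?_
  have h2 := (hC.mem_posRoots.1 hp).1.pairing_self
  rw [C.eq_sum_simpleRoot p.1, map_sum, LinearMap.sum_apply] at h2
  rw [← h2, sum_mul]
  refine sum_congr rfl fun i _ => ?_
  rw [map_smul, LinearMap.smul_apply, smul_eq_mul]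
  ring

theorem IsFiniteType.sum_pairing_left (hC : C.IsFiniteType) (x : I → ℤ) :
    ∑ p ∈ hC.posRoots, C.pairing x p.2 = 2 * ∑ i, x i := by
  have h : ∀ i, ∑ p ∈ hC.posRoots, C.pairing (C.simpleRoot i) p.2 = 2 := by
    intro i
    have e := hC.sum_erase_reflPair i fun p => C.pairing (C.simpleRoot i) p.2
    simp only [reflPair, ← pairing_reflFun, reflFun_simpleRoot, map_neg, LinearMap.neg_apply,
      sum_neg_distrib] at e
    rw [← sum_erase_add _ _ (hC.simplePair_mem i)]
    simp only [simplePair, pairing_simpleRoot_simpleRoot, C.c_self] at e ⊢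
    omega
  conv_lhs => rw [C.eq_sum_simpleRoot x]
  simp only [map_sum, LinearMap.sum_apply, map_smul, LinearMap.smul_apply, smul_eq_mul]
  rw [sum_comm, mul_sum]
  refine sum_congr rfl fun i _ => ?_
  rw [← mul_sum, h, mul_comm]

theorem IsFiniteType.sum_pairing_right (hC : C.IsFiniteType) (y : I → ℤ) :
    ∑ p ∈ hC.posRoots, C.pairing p.1 y = 2 * ∑ i, y i := by
  have h : ∀ i, ∑ p ∈ hC.posRoots, C.pairing p.1 (C.simpleRoot i) = 2 := by
    intro i
    have e := hC.sum_erase_reflPair i fun p => C.pairing p.1 (C.simpleRoot i)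
    have hr : C.corootReflFun i (C.simpleRoot i) = -C.simpleRoot i := by
      rw [corootReflFun_eq, pairing_simpleRoot_simpleRoot, C.c_self]
      module
    simp only [reflPair, pairing_reflFun, hr, map_neg, sum_neg_distrib] at e
    rw [← sum_erase_add _ _ (hC.simplePair_mem i)]
    simp only [simplePair, pairing_simpleRoot_simpleRoot, C.c_self] at e ⊢
    omega
  conv_lhs => rw [C.eq_sum_simpleRoot y]
  simp only [map_sum, map_smul, smul_eq_mul]
  rw [sum_comm, mul_sum]
  refine sum_congr rfl fun i _ => ?_
  rw [← mul_sum, h, mul_comm]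

theorem IsHighest.mem_posRoots (hC : C.IsFiniteType) {θ θv : I → ℤ} (h : C.IsHighest θ θv) :
    (θ, θv) ∈ hC.posRoots :=
  hC.mem_posRoots.2 ⟨h.1, h.dominant.nonneg hC h.1⟩

theorem IsHighest.fst_ne (hC : C.IsFiniteType) {θ θv : I → ℤ} (h : C.IsHighest θ θv)
    {p : (I → ℤ) × (I → ℤ)} (hp : p ∈ hC.posRoots.erase (θ, θv)) : p.1 ≠ θ := by
  obtain ⟨hne, hp⟩ := mem_erase.1 hp
  intro e
  refine hne (Prod.ext e ?_)
  have h1 := (hC.mem_posRoots.1 hp).1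
  rw [e] at h1
  exact h1.coroot_unique h.1

theorem IsHighest.pairing_eq_zero_or_one (hC : C.IsFiniteType) (hirr : C.Irreducible)
    {θ θv : I → ℤ} (h : C.IsHighest θ θv) {p : (I → ℤ) × (I → ℤ)}
    (hp : p ∈ hC.posRoots.erase (θ, θv)) :
    C.pairing p.1 θv = 0 ∨ C.pairing p.1 θv = 1 := by
  obtain ⟨hr, h0⟩ := hC.mem_posRoots.1 (mem_erase.1 hp).2
  have h1 := h.pairing_le_one hC hirr hr (h.fst_ne hC hp)
  have h2 := h.pairing_nonneg h0
  omega

/-- The scalar by which `casimir 1` acts is the Coxeter number. -/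
theorem IsHighest.casimir_one (hC : C.IsFiniteType) (hirr : C.Irreducible)
    {θ θv : I → ℤ} (h : C.IsHighest θ θv) {κ : ℤ}
    (hκ : ∀ x, hC.casimir (fun _ => 1) x = κ • x) : κ = 1 + ∑ i, θ i := by
  have e : C.pairing (hC.casimir (fun _ => 1) θ) θv = 2 + 2 * ∑ i, θ i := by
    rw [hC.casimir_apply, map_sum, LinearMap.sum_apply, ← hC.sum_pairing_left θ,
      ← sum_erase_add _ _ (h.mem_posRoots hC), ← sum_erase_add _ _ (h.mem_posRoots hC)]
    simp only [map_smul, LinearMap.smul_apply, smul_eq_mul, one_mul, h.1.pairing_self]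
    have hs : ∑ p ∈ hC.posRoots.erase (θ, θv), C.pairing θ p.2 * C.pairing p.1 θv
        = ∑ p ∈ hC.posRoots.erase (θ, θv), C.pairing θ p.2 := by
      refine sum_congr rfl fun p hp => ?_
      obtain ⟨hr, -⟩ := hC.mem_posRoots.1 (mem_erase.1 hp).2
      rcases h.pairing_eq_zero_or_one hC hirr hp with h0 | h0
      · have e1 := h.1.sform_mul_pairing p.1
        have e2 := hr.sform_mul_pairing θ
        rw [h0, mul_zero, C.sform_comm θ p.1] at e1
        rw [← e1] at e2
        rw [(mul_eq_zero.1 e2).resolve_left hr.sform_self_pos.ne', zero_mul]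
      · rw [h0, mul_one]
    rw [hs]
    ring
  rw [hκ, map_smul, LinearMap.smul_apply, h.1.pairing_self, smul_eq_mul] at e
  omega

/-- The scalar by which `casimir (β ↦ (β, β))` acts is `2 r` times the dual Coxeter number. -/
theorem IsHighest.casimir_sform (hC : C.IsFiniteType) (hirr : C.Irreducible)
    {θ θv : I → ℤ} (h : C.IsHighest θ θv) {κ : ℤ}
    (hκ : ∀ x, hC.casimir (fun p => C.sform p.1 p.1) x = κ • x) :
    κ = 2 * C.r * (1 + ∑ i, θv i) := by
  have e : C.pairing (hC.casimir (fun p => C.sform p.1 p.1) θ) θv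
      = C.sform θ θ * (2 + 2 * ∑ i, θv i) := by
    rw [hC.casimir_apply, map_sum, LinearMap.sum_apply, ← hC.sum_pairing_right θv,
      ← sum_erase_add _ _ (h.mem_posRoots hC), ← sum_erase_add _ _ (h.mem_posRoots hC)]
    simp only [map_smul, LinearMap.smul_apply, smul_eq_mul, h.1.pairing_self]
    rw [add_left_comm, mul_add, mul_sum]
    congr 1
    · refine sum_congr rfl fun p hp => ?_
      obtain ⟨hr, -⟩ := hC.mem_posRoots.1 (mem_erase.1 hp).2
      have e1 := h.1.sform_mul_pairing p.1
      have e2 := hr.sform_mul_pairing θ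
      rw [C.sform_comm p.1 θ, ← e1] at e2
      rw [e2]
      rcases h.pairing_eq_zero_or_one hC hirr hp with h0 | h0 <;> simp [h0]
    · ring
  rw [hκ, map_smul, LinearMap.smul_apply, h.1.pairing_self, smul_eq_mul,
    h.sform_self hC hirr] at e
  linarith

/-- For a reduced word of the longest element, twice the sum of the `d i` over its letters is
`n r h^∨`, and twice its length is `n h`, where `n` is the rank. -/
theorem IsFiniteType.sum_reducedWord_w₀ (hC : C.IsFiniteType) (hirr : C.Irreducible) [Nonempty I]
    {ω : List I} (hω : C.IsReducedWord ω C.w₀) :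
    (ω.map fun i => 2 * (C.d i : ℤ)).sum = Fintype.card I * (C.r * C.dualCoxeterNumber) ∧
      2 * (ω.length : ℤ) = Fintype.card I * C.coxeterNumber := by
  obtain ⟨h1, hred⟩ := isReducedWord_iff.1 hω
  have h := hC.isHighest_highestRootPair hirr
  constructor
  · have hg : ∀ i p, C.sform (C.reflPair i p).1 (C.reflPair i p).1 = C.sform p.1 p.1 :=
      fun i p => C.sform_reflFun i _ _
    obtain ⟨κ, hκ⟩ := hC.exists_casimir_eq_smul hirr (g := fun p => C.sform p.1 p.1) hg
    have e1 := hC.two_mul_sum_eq hκ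
    have e2 := hC.invSum_sword (f := fun p => C.sform p.1 p.1) hg hred
    rw [h1] at e2
    rw [← hC.invSum_longest, e2, h.casimir_sform hC hirr hκ] at e1
    simp only [simplePair, sform_simpleRoot_self] at e1
    rw [dualCoxeterNumber]
    linarith
  · obtain ⟨κ, hκ⟩ := hC.exists_casimir_eq_smul hirr (g := fun _ => 1) fun _ _ => rfl
    have e1 := hC.two_mul_sum_eq hκ
    have e2 := hC.invSum_sword (f := fun _ => 1) (fun _ _ => rfl) hred
    rw [h1] at e2
    rw [← hC.invSum_longest, e2, h.casimir_one hC hirr hκ] at e1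
    simpa [coxeterNumber] using e1

end Casimir

/-! ### Acyclicity of the graph and products of the parameters along walks -/

section Acyclic

variable {I : Type*} [Fintype I] [DecidableEq I] {C : SymGCM I}

/-- In finite type the graph has no cycles: for a cycle, the sum of the normalized simple roots
`α i / √(d i)` over its vertices would have nonpositive norm. -/
theorem IsFiniteType.isAcyclic (hC : C.IsFiniteType) : C.graph.IsAcyclic := by
  intro u p hp
  let v : I → ℝ := fun a => if a ∈ p.support then (√(C.d a : ℝ))⁻¹ else 0
  have hdp : ∀ a, 0 < √(C.d a : ℝ) := fun a => Real.sqrt_pos.2 (by exact_mod_cast C.d_pos a)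
  have hv : v ≠ 0 := fun h => by
    have := congrFun h u
    simp only [v, p.start_mem_support, if_true, Pi.zero_apply, inv_eq_zero] at this
    exact (hdp u).ne' this
  have hpos := Matrix.PosDef.dotProduct_mulVec_pos hC hv
  refine hpos.not_ge ?_
  have hv0 : ∀ a, 0 ≤ v a := fun a => by
    simp only [v]
    split_ifs
    · exact (inv_pos.2 (hdp a)).le
    · exact le_rfl
  have hM : ∀ a b, a ≠ b → v a * (((C.d a : ℤ) * C.c a b : ℤ) * v b) ≤ 0 := by
    intro a b hab
    refine mul_nonpos_of_nonneg_of_nonpos (hv0 a) (mul_nonpos_of_nonpos_of_nonneg ?_ (hv0 b))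
    exact_mod_cast mul_nonpos_of_nonneg_of_nonpos (by positivity) (C.c_nonpos a b hab)
  have hedge : ∀ a b, a ∈ p.support → b ∈ p.support → C.graph.Adj a b →
      v a * (((C.d a : ℤ) * C.c a b : ℤ) * v b) ≤ -1 := by
    intro a b ha hb hab
    have hcc : 1 ≤ C.c a b * C.c b a := by
      have h1 : C.c a b < 0 := hab
      have h2 := C.c_neg_symm h1
      nlinarith
    have hle : √(C.d a : ℝ) * √(C.d b : ℝ) ≤ -(((C.d a : ℤ) * C.c a b : ℤ) : ℝ) := by
      rw [← Real.sqrt_mul (by positivity)]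
      apply Real.sqrt_le_iff.2
      constructor
      · have h1 : (C.d a : ℤ) * C.c a b ≤ 0 :=
          mul_nonpos_of_nonneg_of_nonpos (by positivity) (le_of_lt hab)
        have : (((C.d a : ℤ) * C.c a b : ℤ) : ℝ) ≤ 0 := by exact_mod_cast h1
        linarith
      · have h1 : (C.d a : ℤ) * C.d b ≤ (-(C.d a * C.c a b)) ^ 2 := by
          have e : (-((C.d a : ℤ) * C.c a b)) ^ 2
              = (C.d a * C.d b) * (C.c a b * C.c b a) := by
            linear_combination ((C.d a : ℤ) * C.c a b) * C.symm a b
          rw [e]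
          exact le_mul_of_one_le_right (by positivity) hcc
        exact_mod_cast h1
    simp only [v, ha, hb, if_true]
    rw [← mul_assoc, mul_right_comm, ← mul_inv, inv_mul_eq_div,
      div_le_iff₀ (mul_pos (hdp a) (hdp b))]
    linarith
  simp only [dotProduct, Matrix.mulVec, Matrix.of_apply, Pi.star_apply, star_trivial, mul_sum]
  refine sum_nonpos fun a _ => ?_
  by_cases ha : a ∈ p.support
  · -- The diagonal term is `2`, and the two neighbours of `a` on the cycle contribute at most `-2`.
    obtain ⟨b, b', hbb, hN⟩ := Set.ncard_eq_two.1 (hp.ncard_neighborSet_toSubgraph_eq_two ha)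
    have hb : p.toSubgraph.Adj a b := by
      change b ∈ p.toSubgraph.neighborSet a
      rw [hN]
      simp
    have hb' : p.toSubgraph.Adj a b' := by
      change b' ∈ p.toSubgraph.neighborSet a
      rw [hN]
      simp
    have hab := hb.adj_sub.ne
    have hab' := hb'.adj_sub.ne
    have h1 := hedge a b ha ((p.mem_verts_toSubgraph).1 hb.snd_mem) hb.adj_sub
    have h2 := hedge a b' ha ((p.mem_verts_toSubgraph).1 hb'.snd_mem) hb'.adj_sub
    have h3 : v a * (((C.d a : ℤ) * C.c a a : ℤ) * v a) = 2 := by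
      simp only [v, ha, if_true, C.c_self]
      have hs : √(C.d a : ℝ) * √(C.d a : ℝ) = C.d a := Real.mul_self_sqrt (by positivity)
      have := (hdp a).ne'
      push_cast
      generalize √(C.d a : ℝ) = s at hs this ⊢
      rw [← hs]
      field_simp
    rw [← sum_sdiff (subset_univ ({a, b, b'} : Finset I)), sum_insert (by simp [hab, hab']),
      sum_pair hbb, h3]
    have h4 : ∑ x ∈ univ \ {a, b, b'}, v a * (((C.d a : ℤ) * C.c a x : ℤ) * v x) ≤ 0 := by
      refine sum_nonpos fun x hx => hM a x ?_
      rintro rfl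
      simp at hx
    linarith
  · simp [v, ha]

theorem muGam_mul_muGam (C : SymGCM I) {i j : I} (h : C.c i j < 0) :
    C.muGam i j 1 * C.muGam j i 1 = 1 := by
  have h' := C.c_neg_symm h
  have hg : 1 ≤ C.g i j := Nat.pos_of_ne_zero fun h0 => by
    rw [g, Int.gcd_eq_zero_iff] at h0
    omega
  rw [muGam, muGam, dif_pos ⟨h, le_rfl, hg⟩, dif_pos ⟨h', le_rfl, C.g_comm i j ▸ hg⟩]
  rw [ofGen, ofGen, ← ofAdd_add, ← ofAdd_zero]
  congr 1
  rw [← QuotientAddGroup.mk_add, QuotientAddGroup.eq_zero_iff]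
  exact AddSubgroup.subset_closure ⟨i, j, 1, h, le_rfl, hg, rfl⟩

theorem walkMu_append {i j k : I} (p : C.graph.Walk i j) (p' : C.graph.Walk j k) :
    C.walkMu (p.append p') = C.walkMu p * C.walkMu p' := by
  induction p with
  | nil => simp [walkMu]
  | cons h p ih => rw [SimpleGraph.Walk.cons_append, walkMu, walkMu, ih, mul_assoc]

/-- The product of the parameters along a walk depends only on its end points. -/
theorem IsFiniteType.walkMu_eq_of_isPath (hC : C.IsFiniteType) {i j : I}
    (p P : C.graph.Walk i j) (hP : P.IsPath) : C.walkMu p = C.walkMu P := by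
  have huniq : ∀ {a b : I} (Q Q' : C.graph.Walk a b), Q.IsPath → Q'.IsPath → Q = Q' := by
    intro a b Q Q' h h'
    have := hC.isAcyclic.subsingleton_path a b
    exact congrArg Subtype.val (Subsingleton.elim (⟨Q, h⟩ : C.graph.Path a b) ⟨Q', h'⟩)
  induction p with
  | nil => rw [huniq P .nil hP .nil]
  | @cons i k j h p ih =>
    have hQ : p.bypass.IsPath := p.bypass_isPath
    rw [walkMu, ih p.bypass hQ]
    by_cases hi : i ∈ p.bypass.support
    · have h1 := p.bypass.take_spec hi
      have h2 : p.bypass.takeUntil i hi = .cons h.symm .nil :=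
        huniq _ _ (hQ.takeUntil hi) (by simp [SimpleGraph.Walk.cons_isPath_iff, h.ne.symm])
      have h3 : p.bypass.dropUntil i hi = P := huniq _ _ (hQ.dropUntil hi) hP
      rw [← h1, walkMu_append, h2, h3, walkMu, walkMu, mul_one, ← mul_assoc,
        C.muGam_mul_muGam h, one_mul]
    · rw [← huniq (.cons h p.bypass) P ((SimpleGraph.Walk.cons_isPath_iff _ _).2 ⟨hQ, hi⟩) hP,
        walkMu]

theorem IsFiniteType.muPath_eq (hC : C.IsFiniteType) {i j : I} (p : C.graph.Walk i j) :
    C.muPath i j = C.walkMu p := by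
  have hne : Nonempty (C.graph.Walk i j) := ⟨p⟩
  rw [muPath, dif_pos hne, hC.walkMu_eq_of_isPath _ p.bypass p.bypass_isPath,
    hC.walkMu_eq_of_isPath p p.bypass p.bypass_isPath]

theorem IsFiniteType.muPath_mul_muPath (hC : C.IsFiniteType) (hirr : C.Irreducible) (i j k : I) :
    C.muPath i j * C.muPath j k = C.muPath i k := by
  obtain ⟨p⟩ := hirr i j
  obtain ⟨p'⟩ := hirr j k
  rw [hC.muPath_eq p, hC.muPath_eq p', hC.muPath_eq (p.append p'), walkMu_append]

theorem IsFiniteType.muPath_self (hC : C.IsFiniteType) (i : I) : C.muPath i i = 1 := by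
  rw [hC.muPath_eq .nil, walkMu]

theorem IsFiniteType.muPath_adj (hC : C.IsFiniteType) {i j : I} (h : C.c i j < 0) :
    C.muPath i j = C.muGam i j 1 := by
  have h' : C.graph.Adj i j := h
  rw [hC.muPath_eq (.cons h' .nil), walkMu, walkMu, mul_one]

end Acyclic

/-! ### The field `ℚ(Γ)` and the specialization of all parameters to `1` -/

section Specialization

variable {I : Type*} {C : SymGCM I}

theorem gamK_mul (x y : C.Gam) : C.gamK (x * y) = C.gamK x * C.gamK y := by
  rw [gamK, map_mul, map_mul, gamK, gamK]

theorem gamK_one : C.gamK 1 = 1 := by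
  rw [gamK, map_one, map_one]

theorem gamK_ne_zero (x : C.Gam) : C.gamK x ≠ 0 := fun h => by
  have := C.gamK_mul x x⁻¹
  rw [h, zero_mul, mul_inv_cancel, gamK_one] at this
  exact one_ne_zero this

theorem gamK_inv (x : C.Gam) : C.gamK x⁻¹ = (C.gamK x)⁻¹ := by
  refine eq_inv_of_mul_eq_one_left ?_
  rw [← gamK_mul, inv_mul_cancel, gamK_one]

theorem gamK_pow (x : C.Gam) (n : ℕ) : C.gamK (x ^ n) = C.gamK x ^ n := by
  rw [gamK, map_pow, map_pow, gamK]

theorem gamK_zpow (x : C.Gam) (n : ℤ) : C.gamK (x ^ n) = C.gamK x ^ n := by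
  cases n with
  | ofNat n => simpa using gamK_pow x n
  | negSucc n => rw [zpow_negSucc, zpow_negSucc, gamK_inv, gamK_pow]

theorem gamK_injective : Function.Injective C.gamK :=
  (IsFractionRing.injective (MonoidAlgebra ℤ C.Gam) C.K).comp MonoidAlgebra.of_injective

/-- The augmentation `ℤ[Γ] → ℤ`, which specializes all parameters to `1`. -/
noncomputable def augment (C : SymGCM I) : MonoidAlgebra ℤ C.Gam →+* ℤ :=
  (MonoidAlgebra.lift ℤ ℤ C.Gam 1 : MonoidAlgebra ℤ C.Gam →ₐ[ℤ] ℤ)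

/-- The element `x` of `ℚ(Γ)` lies in `ℤ[Γ]` and specializes to `n` when all parameters are set
to `1`. -/
def Specializes (C : SymGCM I) (x : C.K) (n : ℤ) : Prop :=
  ∃ a, algebraMap (MonoidAlgebra ℤ C.Gam) C.K a = x ∧ C.augment a = n

namespace Specializes

variable {x y : C.K} {m n : ℤ}

theorem add (hx : C.Specializes x m) (hy : C.Specializes y n) : C.Specializes (x + y) (m + n) := by
  obtain ⟨a, rfl, rfl⟩ := hx
  obtain ⟨b, rfl, rfl⟩ := hy
  exact ⟨a + b, map_add _ _ _, map_add _ _ _⟩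

theorem mul (hx : C.Specializes x m) (hy : C.Specializes y n) : C.Specializes (x * y) (m * n) := by
  obtain ⟨a, rfl, rfl⟩ := hx
  obtain ⟨b, rfl, rfl⟩ := hy
  exact ⟨a * b, map_mul _ _ _, map_mul _ _ _⟩

theorem neg (hx : C.Specializes x m) : C.Specializes (-x) (-m) := by
  obtain ⟨a, rfl, rfl⟩ := hx
  exact ⟨-a, map_neg _ _, map_neg _ _⟩

theorem sub (hx : C.Specializes x m) (hy : C.Specializes y n) : C.Specializes (x - y) (m - n) := by
  rw [sub_eq_add_neg, sub_eq_add_neg]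
  exact hx.add hy.neg

theorem zero : C.Specializes 0 0 := ⟨0, map_zero _, map_zero _⟩

theorem one : C.Specializes 1 1 := ⟨1, map_one _, map_one _⟩

theorem sum {ι : Type*} (s : Finset ι) {f : ι → C.K} {g : ι → ℤ}
    (h : ∀ i ∈ s, C.Specializes (f i) (g i)) : C.Specializes (∑ i ∈ s, f i) (∑ i ∈ s, g i) := by
  classical
  induction s using Finset.induction_on with
  | empty => simpa using zero
  | insert a s ha ih =>
    rw [sum_insert ha, sum_insert ha]
    exact (h a (mem_insert_self a s)).add (ih fun i hi => h i (mem_insert_of_mem hi))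

theorem gamK (x : C.Gam) : C.Specializes (C.gamK x) 1 :=
  ⟨MonoidAlgebra.of ℤ C.Gam x, rfl, by simp [augment]⟩

theorem ne_zero (hx : C.Specializes x n) (hn : n ≠ 0) : x ≠ 0 := by
  rintro rfl
  obtain ⟨a, h, rfl⟩ := hx
  have := IsFractionRing.injective (MonoidAlgebra ℤ C.Gam) C.K (h.trans (map_zero _).symm)
  exact hn (by rw [this, map_zero])

/-- A root of unity that specializes to `1` is `1`: otherwise `1 + x + ⋯ + x ^ (N - 1) = 0`, but
the left-hand side specializes to `N`. -/
theorem eq_one_of_pow_eq_one (hx : C.Specializes x 1) {N : ℕ} (hN : N ≠ 0) (h : x ^ N = 1) :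
    x = 1 := by
  by_contra hne
  have hpow : ∀ k, C.Specializes (x ^ k) 1 := by
    intro k
    induction k with
    | zero => simpa using one
    | succ k ih => simpa [pow_succ] using ih.mul hx
  have hs : C.Specializes (∑ k ∈ range N, x ^ k) (∑ k ∈ range N, 1) :=
    sum _ fun k _ => hpow k
  refine hs.ne_zero (by simpa using hN) ?_
  have := geom_sum_mul x N
  rw [h, sub_self] at this
  exact (mul_eq_zero.1 this).resolve_right (sub_ne_zero.2 hne)

end Specializes

theorem q_ne_zero : C.q ≠ 0 := gamK_ne_zero _

theorem t_ne_zero : C.t ≠ 0 := gamK_ne_zero _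

/-- The degree of an element of `Γ` in `q`. -/
noncomputable def qDegree (C : SymGCM I) : ((Gen C →₀ ℤ) ⧸ C.relSubgroup) →+ ℤ :=
  QuotientAddGroup.lift _
    (Finsupp.liftAddHom fun x => zmultiplesHom ℤ (match x with
      | Gen.q => 1
      | Gen.t => 0
      | Gen.mu _ _ _ _ _ _ => 0))
    (by
      rw [relSubgroup, AddSubgroup.closure_le]
      rintro x ⟨i, j, a, hij, h1, ha, rfl⟩
      simp [Gen.swap])

theorem q_pow_ne_one {n : ℕ} (hn : n ≠ 0) : C.q ^ n ≠ 1 := by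
  intro h
  rw [q, ← gamK_pow, ← gamK_one] at h
  have h1 := congrArg (fun x : C.Gam => C.qDegree x.toAdd) (gamK_injective h)
  simp only [toAdd_pow, map_nsmul, toAdd_one, map_zero] at h1
  have h2 : C.qDegree (C.ofGen Gen.q).toAdd = 1 := by
    simp [qDegree, ofGen]
  rw [h2] at h1
  exact hn (by simpa using h1)

theorem q_pow_sub_inv_ne_zero {n : ℕ} (hn : n ≠ 0) : C.q ^ n - (C.q ^ n)⁻¹ ≠ 0 := by
  intro h
  have h0 : C.q ^ n ≠ 0 := pow_ne_zero _ q_ne_zero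
  refine q_pow_ne_one (C := C) (n := n + n) (by omega) ?_
  rw [pow_add]
  nth_rewrite 1 [sub_eq_zero.1 h]
  exact inv_mul_cancel₀ h0

theorem qInt_ne_zero {n : ℕ} (hn : n ≠ 0) : qInt n C.q ≠ 0 := by
  have := q_pow_sub_inv_ne_zero (C := C) one_ne_zero
  rw [pow_one] at this
  exact div_ne_zero (q_pow_sub_inv_ne_zero hn) this

theorem qInt_one_left {F : Type*} [Field F] {x : F} (hx : x - x⁻¹ ≠ 0) : qInt 1 x = 1 := by
  rw [qInt, pow_one, div_self hx]

theorem qInt_two_left {F : Type*} [Field F] {x : F} (hx : x - x⁻¹ ≠ 0) :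
    qInt 2 x = x + x⁻¹ := by
  rw [qInt, div_eq_iff hx, ← inv_pow]
  ring

theorem qInt_three_left {F : Type*} [Field F] {x : F} (h0 : x ≠ 0) (hx : x - x⁻¹ ≠ 0) :
    qInt 3 x = x ^ 2 + 1 + (x ^ 2)⁻¹ := by
  rw [qInt, div_eq_iff hx]
  field_simp
  ring

theorem phi_gamK (x : C.Gam) : C.phi (C.gamK x) = C.gamK (C.phiGam x) := by
  simp [phi, gamK]

theorem phi_q : C.phi C.q = C.q := by
  rw [q, phi_gamK]
  congr 1
  simp [phiGam, ofGen, phiHom, freeSwap, Gen.swap]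

theorem phi_t : C.phi C.t = C.t := by
  rw [t, phi_gamK]
  congr 1
  simp [phiGam, ofGen, phiHom, freeSwap, Gen.swap]

end Specialization

/-! ### The operators `T i` -/

section Operators

variable {I : Type*} [Fintype I] [DecidableEq I] {C : SymGCM I}

/-- The pairing of `α k` with the deformed coroot of `α i`. -/
noncomputable def defPairing (C : SymGCM I) (i k : I) : C.K :=
  (C.q ^ C.d i)⁻¹ * C.t * C.defC i k

/-- The linear form `x ↦ (αᵢ^∨, x)_Γ`. -/
noncomputable def corootForm (C : SymGCM I) (i : I) : Module.Dual C.K (I → C.K) :=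
  ∑ k, C.defPairing i k • LinearMap.proj k

/-- The square root `t q ^ (- d i)` of minus the eigenvalue of `T i` on `α i`. -/
noncomputable def rootX (C : SymGCM I) (i : I) : C.K := C.t * (C.q ^ C.d i)⁻¹

theorem corootForm_apply (i : I) (x : I → C.K) :
    C.corootForm i x = ∑ k, C.defPairing i k * x k := by
  simp [corootForm, LinearMap.sum_apply]

@[simp] theorem corootForm_alpha (i k : I) : C.corootForm i (C.alpha k) = C.defPairing i k := by
  rw [corootForm_apply]
  simp [alpha, Pi.single_apply]

theorem T_apply (i : I) (x : I → C.K) :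
    C.T i x = x - C.corootForm i x • C.alpha i := by
  have hphi : C.phi ((C.q ^ C.d i)⁻¹ * C.t * (qInt (C.d i) C.q)⁻¹)
      = (C.q ^ C.d i)⁻¹ * C.t * (qInt (C.d i) C.q)⁻¹ := by
    simp only [map_mul, map_inv₀, map_pow, phi_q, phi_t, qInt, map_div₀, map_sub]
  have h : C.form (C.alphaCheck i) x = C.corootForm i x := by
    rw [form, corootForm_apply, sum_eq_single i]
    · refine sum_congr rfl fun k _ => ?_
      have : C.alphaCheck i i = (C.q ^ C.d i)⁻¹ * C.t * (qInt (C.d i) C.q)⁻¹ := by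
        simp [alphaCheck, alpha]
      rw [this, hphi, defPairing]
      have h0 := qInt_ne_zero (C := C) (C.d_pos i).ne'
      field_simp
    · intro k _ hk
      simp [alphaCheck, alpha, hk]
    · simp
  rw [← h]
  rfl

theorem rootX_ne_zero (i : I) : C.rootX i ≠ 0 :=
  mul_ne_zero t_ne_zero (inv_ne_zero (pow_ne_zero _ q_ne_zero))

theorem defPairing_self (i : I) : C.defPairing i i = 1 + C.rootX i ^ 2 := by
  have hq : C.q ≠ 0 := q_ne_zero
  have ht : C.t ≠ 0 := t_ne_zero
  rw [defPairing, defC, if_pos rfl, rootX]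
  field_simp

theorem defPairing_eq_zero {i j : I} (hij : i ≠ j) (h : C.c i j = 0) : C.defPairing i j = 0 := by
  rw [defPairing, defC, if_neg hij, if_neg (by omega), mul_zero]

/-- In finite type one of `c i j`, `c j i` is `-1` for `i ∼ j`. -/
theorem IsFiniteType.c_cases (hC : C.IsFiniteType) {i j : I} (h : C.c i j < 0) :
    C.g i j = 1 ∧ ((C.c i j = -1 ∧ C.c j i = -1) ∨ (C.c i j = -1 ∧ C.c j i = -2) ∨
      (C.c i j = -2 ∧ C.c j i = -1) ∨ (C.c i j = -1 ∧ C.c j i = -3) ∨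
      (C.c i j = -3 ∧ C.c j i = -1)) := by
  have h' := C.c_neg_symm h
  have hij : i ≠ j := by
    rintro rfl
    rw [C.c_self] at h
    omega
  have h3 := hC.c_mul_c_le hij
  unfold g
  generalize C.c i j = x at *
  generalize C.c j i = y at *
  have hx : -3 ≤ x := by nlinarith
  have hy : -3 ≤ y := by nlinarith
  interval_cases x <;> interval_cases y <;> first | omega | simp

theorem IsFiniteType.defPairing_of_neg (hC : C.IsFiniteType) {i j : I} (h : C.c i j < 0) :
    C.defPairing i j = -(C.rootX i * qInt (C.c i j).natAbs (C.q ^ C.d i)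
      * C.gamK (C.muGam i j 1)) := by
  have hij : i ≠ j := by
    rintro rfl
    rw [C.c_self] at h
    omega
  rw [defPairing, defC, if_neg hij, if_pos h, f, (hC.c_cases h).1, Icc_self, sum_singleton,
    Nat.div_one, rootX]
  ring

theorem q_pow_d_sub_inv_ne_zero (i : I) : C.q ^ C.d i - (C.q ^ C.d i)⁻¹ ≠ 0 :=
  q_pow_sub_inv_ne_zero (C.d_pos i).ne'

theorem gamK_mul_gamK_of_neg {i j : I} (h : C.c i j < 0) :
    C.gamK (C.muGam i j 1) * C.gamK (C.muGam j i 1) = 1 := by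
  rw [← gamK_mul, C.muGam_mul_muGam h, gamK_one]

/-- The operators `T i` satisfy the braid relations. -/
theorem IsFiniteType.T_braid (hC : C.IsFiniteType) {i j : I} (hij : i ≠ j) :
    ((altWord (C.braidOrder i j) i j).map C.T).prod
      = ((altWord (C.braidOrder i j) j i).map C.T).prod := by
  have hq : ∀ i, C.q ^ C.d i ≠ 0 := fun i => pow_ne_zero _ q_ne_zero
  have hneg : C.c i j * C.c j i ≠ 0 → C.c i j < 0 := fun h =>
    lt_of_le_of_ne (C.c_nonpos i j hij) (left_ne_zero_of_mul h)
  have hprod : C.c i j < 0 → C.defPairing i j * C.defPairing j i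
      = C.rootX i * C.rootX j * (qInt (C.c i j).natAbs (C.q ^ C.d i)
        * qInt (C.c j i).natAbs (C.q ^ C.d j)) := by
    intro h
    rw [hC.defPairing_of_neg h, hC.defPairing_of_neg (C.c_neg_symm h)]
    linear_combination (C.rootX i * C.rootX j * (qInt (C.c i j).natAbs (C.q ^ C.d i)
        * qInt (C.c j i).natAbs (C.q ^ C.d j))) * gamK_mul_gamK_of_neg h
  have hsymm := C.symm i j
  have n1 := q_pow_d_sub_inv_ne_zero (C := C) i
  have n2 := q_pow_d_sub_inv_ne_zero (C := C) j
  refine braid_relation C (e := C.alpha) (φ := C.corootForm) (X := C.rootX) T_apply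
    (fun i => by rw [corootForm_alpha, defPairing_self]) (hC.c_mul_c_le hij)
    (C.c_mul_c_nonneg hij) ?_ ?_ ?_ ?_
  all_goals
    intro h
    rw [corootForm_alpha, corootForm_alpha]
  · have h1 : C.c i j = 0 := by
      rcases mul_eq_zero.1 h with h | h
      · exact h
      · exact (C.c_zero_iff i j).2 h
    exact ⟨defPairing_eq_zero hij h1, defPairing_eq_zero hij.symm ((C.c_zero_iff i j).1 h1)⟩
  · have hc := hneg (by omega)
    rw [hprod hc]
    obtain ⟨h1, h2⟩ | ⟨h1, h2⟩ | ⟨h1, h2⟩ | ⟨h1, h2⟩ | ⟨h1, h2⟩ := (hC.c_cases hc).2 <;>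
      rw [h1, h2] at h hsymm <;> try omega
    have hd : C.d i = C.d j := by omega
    have hX : C.rootX i = C.rootX j := by rw [rootX, rootX, hd]
    refine ⟨hX, ?_⟩
    rw [h1, h2, show (-1 : ℤ).natAbs = 1 from rfl, qInt_one_left n1, qInt_one_left n2, hX]
    ring
  · have hc := hneg (by omega)
    rw [hprod hc]
    obtain ⟨h1, h2⟩ | ⟨h1, h2⟩ | ⟨h1, h2⟩ | ⟨h1, h2⟩ | ⟨h1, h2⟩ := (hC.c_cases hc).2 <;>
      rw [h1, h2] at h hsymm <;> try omega
    · have hd : C.d i = C.d j * 2 := by omega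
      rw [h1, h2, show (-1 : ℤ).natAbs = 1 from rfl, show (-2 : ℤ).natAbs = 2 from rfl,
        qInt_one_left n1, qInt_two_left n2, rootX, rootX, hd, pow_mul]
      have := hq j
      field_simp
      ring
    · have hd : C.d j = C.d i * 2 := by omega
      rw [h1, h2, show (-1 : ℤ).natAbs = 1 from rfl, show (-2 : ℤ).natAbs = 2 from rfl,
        qInt_one_left n2, qInt_two_left n1, rootX, rootX, hd, pow_mul]
      have := hq i
      field_simp
  · have hc := hneg (by omega)
    rw [hprod hc]
    obtain ⟨h1, h2⟩ | ⟨h1, h2⟩ | ⟨h1, h2⟩ | ⟨h1, h2⟩ | ⟨h1, h2⟩ := (hC.c_cases hc).2 <;>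
      rw [h1, h2] at h hsymm <;> try omega
    · have hd : C.d i = C.d j * 3 := by omega
      rw [h1, h2, show (-1 : ℤ).natAbs = 1 from rfl, show (-3 : ℤ).natAbs = 3 from rfl,
        qInt_one_left n1, qInt_three_left (hq j) n2, rootX, rootX, hd, pow_mul]
      have := hq j
      field_simp
      ring
    · have hd : C.d j = C.d i * 3 := by omega
      rw [h1, h2, show (-1 : ℤ).natAbs = 1 from rfl, show (-3 : ℤ).natAbs = 3 from rfl,
        qInt_one_left n2, qInt_three_left (hq i) n1, rootX, rootX, hd, pow_mul]
      have := hq i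
      field_simp
      ring

theorem specializes_q_pow (n : ℕ) : C.Specializes (C.q ^ n) 1 := by
  rw [q, ← gamK_pow]
  exact .gamK _

theorem specializes_q_pow_inv (n : ℕ) : C.Specializes (C.q ^ n)⁻¹ 1 := by
  rw [q, ← gamK_pow, ← gamK_inv]
  exact .gamK _

theorem specializes_rootX (i : I) : C.Specializes (C.rootX i) 1 := by
  have := (Specializes.gamK (C.ofGen .t)).mul (specializes_q_pow_inv (C := C) (C.d i))
  rwa [mul_one] at this

theorem IsFiniteType.specializes_qInt (hC : C.IsFiniteType) {i j : I} (h : C.c i j < 0) :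
    C.Specializes (qInt (C.c i j).natAbs (C.q ^ C.d i)) (-C.c i j) := by
  have n1 := q_pow_d_sub_inv_ne_zero (C := C) i
  obtain h1 | h1 | h1 : C.c i j = -1 ∨ C.c i j = -2 ∨ C.c i j = -3 := by
    have := (hC.c_cases h).2
    omega
  all_goals rw [h1]
  · change C.Specializes (qInt 1 _) 1
    rw [qInt_one_left n1]
    exact .one
  · change C.Specializes (qInt 2 _) (1 + 1)
    rw [qInt_two_left n1]
    exact (specializes_q_pow _).add (specializes_q_pow_inv _)
  · change C.Specializes (qInt 3 _) (1 + 1 + 1)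
    rw [qInt_three_left (pow_ne_zero _ q_ne_zero) n1, ← pow_mul]
    exact ((specializes_q_pow _).add .one).add (specializes_q_pow_inv _)

theorem IsFiniteType.specializes_defPairing (hC : C.IsFiniteType) (i j : I) :
    C.Specializes (C.defPairing i j) (C.c i j) := by
  by_cases hij : i = j
  · subst hij
    rw [defPairing_self, C.c_self, sq]
    exact Specializes.one.add ((specializes_rootX i).mul (specializes_rootX i))
  by_cases h : C.c i j = 0
  · rw [defPairing_eq_zero hij h, h]
    exact .zero
  have hc : C.c i j < 0 := lt_of_le_of_ne (C.c_nonpos i j hij) h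
  rw [hC.defPairing_of_neg hc]
  have := (((specializes_rootX i).mul (hC.specializes_qInt hc)).mul
    (Specializes.gamK (C.muGam i j 1))).neg
  simpa using this

/-- At `q = t = μ = 1` the operators `T i` specialize to the simple reflections. -/
theorem IsFiniteType.specializes_Tword (hC : C.IsFiniteType) (ω : List I) (i j : I) :
    C.Specializes (C.Tword ω (C.alpha i) j) (C.sword ω (C.simpleRoot i) j) := by
  have halpha : ∀ k j, C.Specializes (C.alpha k j) (C.simpleRoot k j) := by
    intro k j
    by_cases hj : j = k
    · subst hj
      simpa [alpha, simpleRoot] using Specializes.one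
    · simpa [alpha, simpleRoot, hj] using Specializes.zero
  induction ω generalizing j with
  | nil => exact halpha i j
  | cons k ω ih =>
    rw [Tword, List.map_cons, List.prod_cons, Module.End.mul_apply, T_apply, sword_cons,
      LinearEquiv.mul_apply, s_apply, reflFun]
    refine (ih j).sub (.mul ?_ (halpha k j))
    rw [corootForm_apply]
    exact Specializes.sum _ fun l _ => (hC.specializes_defPairing k l).mul (ih l)

theorem det_T (i : I) : LinearMap.det (C.T i) = -C.rootX i ^ 2 := by
  have : C.T i = LinearMap.transvection (-C.corootForm i) (C.alpha i) := by
    refine LinearMap.ext fun x => ?_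
    rw [T_apply]
    simp [LinearMap.transvection, sub_eq_add_neg]
  rw [this, LinearMap.transvection.det]
  simp [defPairing_self]

theorem det_Tword_sq (ω : List I) :
    LinearMap.det (C.Tword ω) ^ 2
      = C.q ^ (-(2 * (ω.map fun i => 2 * (C.d i : ℤ)).sum)) * C.t ^ (4 * (ω.length : ℤ)) := by
  have hq : C.q ≠ 0 := q_ne_zero
  have ht : C.t ≠ 0 := t_ne_zero
  induction ω with
  | nil => simp [Tword]
  | cons i ω ih =>
    have e1 : -(2 * ((i :: ω).map fun i => 2 * (C.d i : ℤ)).sum)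
        = -((C.d i * 4 : ℕ) : ℤ) + -(2 * (ω.map fun i => 2 * (C.d i : ℤ)).sum) := by
      rw [List.map_cons, List.sum_cons]
      push_cast
      ring
    have e2 : 4 * ((i :: ω).length : ℤ) = ((4 : ℕ) : ℤ) + 4 * (ω.length : ℤ) := by
      rw [List.length_cons]
      push_cast
      ring
    rw [Tword, List.map_cons, List.prod_cons, map_mul, mul_pow, ← Tword, ih, e1, e2,
      zpow_add₀ hq, zpow_add₀ ht, zpow_neg C.q ((C.d i * 4 : ℕ) : ℤ), zpow_natCast, zpow_natCast,
      det_T, rootX, pow_mul]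
    field_simp

end Operators

/-! ### The operator of the longest element -/

section Main

variable {I : Type*} [Fintype I] [DecidableEq I] {C : SymGCM I}

theorem nu_alpha (i : I) :
    C.nu (C.alpha i) = C.gamK (C.muPath (C.star i) i) • C.alpha (C.star i) := by
  have : C.alpha i = Pi.basisFun C.K I i := by simp [alpha]
  rw [nu, this, Module.Basis.constr_basis]

theorem linearMap_ext_alpha {P Q : Module.End C.K (I → C.K)}
    (h : ∀ i, P (C.alpha i) = Q (C.alpha i)) : P = Q := by
  refine (Pi.basisFun C.K I).ext fun i => ?_
  have : C.alpha i = Pi.basisFun C.K I i := by simp [alpha]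
  rw [← this, h]

theorem IsFiniteType.nu_mul_nu (hC : C.IsFiniteType) (hirr : C.Irreducible) :
    C.nu * C.nu = 1 := by
  refine linearMap_ext_alpha fun i => ?_
  rw [Module.End.mul_apply, nu_alpha, map_smul, nu_alpha, hC.star_star, smul_smul, ← gamK_mul,
    hC.muPath_mul_muPath hirr, hC.muPath_self, gamK_one, one_smul]
  rfl

/-- The operator of the longest element is a multiple of `ν`: it sends the eigenline of `T i` to
that of `T (i^*)`, and the resulting scalars are related by the off-diagonal entries of the
deformed Cartan matrix. -/
theorem IsFiniteType.exists_Tword_eq_smul_nu (hC : C.IsFiniteType) (hirr : C.Irreducible)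
    [Nonempty I] {ω : List I} (hω : C.IsReducedWord ω C.w₀) :
    ∃ κ : C.K, C.Specializes κ (-1) ∧ C.Tword ω = κ • C.nu := by
  have hint : ∀ i x, C.T (C.star i) (C.Tword ω x) = C.Tword ω (C.T i x) := fun i x =>
    LinearMap.congr_fun (hC.intertwine C.T (fun i j hij => hC.T_braid hij) hω i) x
  have hTalpha : ∀ i, C.T i (C.alpha i) = -C.rootX i ^ 2 • C.alpha i := by
    intro i
    rw [T_apply, corootForm_alpha, defPairing_self, add_smul, one_smul, neg_smul]
    abel
  -- `c i` is the coefficient of `α (i^*)` in the image of `α i`.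
  set c : I → C.K := fun i => C.Tword ω (C.alpha i) (C.star i) with hc
  have hspec : ∀ i, C.Specializes (c i) (-1) := by
    intro i
    have := hC.specializes_Tword ω i (C.star i)
    rw [hω.1] at this
    have e : (C.w₀ : (I → ℤ) ≃ₗ[ℤ] (I → ℤ)) (C.simpleRoot i) (C.star i) = -1 := by
      have := congrFun (hC.longest_simpleRoot i) (C.star i)
      simpa [simpleRoot] using this
    rwa [e] at this
  have hline : ∀ i, C.Tword ω (C.alpha i) = c i • C.alpha (C.star i) := by
    intro i
    have e := hint i (C.alpha i)
    rw [hTalpha, T_apply, map_smul] at e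
    have h2 : (1 + C.rootX i ^ 2 : C.K) ≠ 0 := by
      have := (hC.specializes_defPairing i i).ne_zero (by rw [C.c_self]; norm_num)
      rwa [defPairing_self] at this
    have e2 : (1 + C.rootX i ^ 2) • C.Tword ω (C.alpha i)
        = C.corootForm (C.star i) (C.Tword ω (C.alpha i)) • C.alpha (C.star i) := by
      rw [add_smul, one_smul]
      rw [sub_eq_iff_eq_add, neg_smul, neg_add_eq_sub, eq_sub_iff_add_eq] at e
      exact e
    have e3 := congrArg (fun y => (1 + C.rootX i ^ 2 : C.K)⁻¹ • y) e2
    simp only [smul_smul, inv_mul_cancel₀ h2, one_smul] at e3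
    have e4 : c i = (1 + C.rootX i ^ 2)⁻¹
        * C.corootForm (C.star i) (C.Tword ω (C.alpha i)) := by
      have := congrFun e3 (C.star i)
      rw [hc]
      simpa [alpha] using this
    rw [e4]
    exact e3
  have hrel : ∀ i j, C.c i j < 0 → c j * C.gamK (C.muGam (C.star i) (C.star j) 1)
      = C.gamK (C.muGam i j 1) * c i := by
    intro i j hij
    have e := hint i (C.alpha j)
    rw [T_apply, T_apply, map_sub, map_smul, sub_right_inj, hline i, hline j, map_smul,
      corootForm_alpha, corootForm_alpha, smul_smul] at e
    have e2 := congrFun e (C.star i)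
    simp only [alpha, Pi.smul_apply, Pi.single_eq_same, smul_eq_mul, mul_one] at e2
    have hs : C.c (C.star i) (C.star j) < 0 := by rwa [hC.c_star]
    rw [hC.defPairing_of_neg hij, hC.defPairing_of_neg hs, hC.c_star, rootX, rootX, hC.d_star,
      ← rootX] at e2
    have h0 : C.rootX i * qInt (C.c i j).natAbs (C.q ^ C.d i) ≠ 0 :=
      mul_ne_zero (rootX_ne_zero i) ((hC.specializes_qInt hij).ne_zero (by omega))
    refine mul_left_cancel₀ h0 ?_
    linear_combination -e2
  set κ : I → C.K := fun i => c i * C.gamK (C.muPath (C.star i) i)⁻¹ with hκ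
  have hcκ : ∀ i, c i = κ i * C.gamK (C.muPath (C.star i) i) := by
    intro i
    rw [hκ]
    simp only
    rw [mul_assoc, ← gamK_mul, inv_mul_cancel, gamK_one, mul_one]
  have hadj : ∀ i j, C.graph.Adj i j → κ i = κ j := by
    intro i j hij
    have hij' : C.c i j < 0 := hij
    have hs : C.c (C.star i) (C.star j) < 0 := by rwa [hC.c_star]
    have e := hrel i j hij'
    rw [hcκ i, hcκ j, ← hC.muPath_adj hij', ← hC.muPath_adj hs] at e
    have e2 : κ j * C.gamK (C.muPath (C.star i) (C.star j) * C.muPath (C.star j) j)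
        = κ i * C.gamK (C.muPath (C.star i) i * C.muPath i j) := by
      rw [gamK_mul, gamK_mul]
      linear_combination e
    rw [hC.muPath_mul_muPath hirr, hC.muPath_mul_muPath hirr] at e2
    exact (mul_right_cancel₀ (gamK_ne_zero _) e2).symm
  have hwalk : ∀ {a b : I} (_ : C.graph.Walk a b), κ a = κ b := by
    intro a b p
    induction p with
    | nil => rfl
    | cons h _ ih => rw [hadj _ _ h, ih]
  obtain ⟨o⟩ := ‹Nonempty I›
  refine ⟨κ o, ?_, linearMap_ext_alpha fun i => ?_⟩
  · simpa using (hspec o).mul (Specializes.gamK (C.muPath (C.star o) o)⁻¹)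
  · obtain ⟨p⟩ := hirr o i
    rw [hline, LinearMap.smul_apply, nu_alpha, smul_smul, hwalk p, hcκ]

theorem IsFiniteType.Tword_eq (hC : C.IsFiniteType) (hirr : C.Irreducible) {ω : List I}
    (hω : C.IsReducedWord ω C.w₀) :
    C.Tword ω =
      -((C.q ^ (-((C.r : ℤ) * C.dualCoxeterNumber)) * C.t ^ C.coxeterNumber) • C.nu) := by
  rcases isEmpty_or_nonempty I with hI | hI
  · exact Subsingleton.elim _ _
  obtain ⟨κ, hspec, hκ⟩ := hC.exists_Tword_eq_smul_nu hirr hω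
  obtain ⟨h1, h2⟩ := hC.sum_reducedWord_w₀ hirr hω
  obtain ⟨n, hn⟩ : ∃ n, n = Fintype.card I := ⟨_, rfl⟩
  have hn0 : n ≠ 0 := by rw [hn]; exact Fintype.card_ne_zero
  rw [← hn] at h1 h2
  set x : C.Gam := C.ofGen .q ^ (-((C.r : ℤ) * C.dualCoxeterNumber))
    * C.ofGen .t ^ C.coxeterNumber with hx
  have hxK : C.gamK x = C.q ^ (-((C.r : ℤ) * C.dualCoxeterNumber)) * C.t ^ C.coxeterNumber := by
    rw [hx, gamK_mul, gamK_zpow, gamK_zpow, q, t]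
  have hdet : κ ^ (n * 2) = C.gamK x ^ (n * 2) := by
    have e := det_Tword_sq (C := C) ω
    have hnu : LinearMap.det C.nu ^ 2 = 1 := by
      rw [sq, ← map_mul, hC.nu_mul_nu hirr, map_one]
    rw [hκ, LinearMap.det_smul, mul_pow, hnu, mul_one, Module.finrank_fintype_fun_eq_card,
      ← hn, ← pow_mul] at e
    rw [e, hxK, mul_pow, ← zpow_natCast, ← zpow_natCast, ← zpow_mul, ← zpow_mul, h1,
      show 4 * (ω.length : ℤ) = 2 * (2 * (ω.length : ℤ)) by ring, h2]
    congr 2 <;> push_cast <;> ring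
  have hunit : -(κ * C.gamK x⁻¹) = 1 := by
    refine Specializes.eq_one_of_pow_eq_one (N := n * 2) ?_ (by omega) ?_
    · simpa using (hspec.mul (Specializes.gamK x⁻¹)).neg
    · rw [Even.neg_pow ⟨n, by ring⟩, mul_pow, hdet, ← mul_pow, ← gamK_mul, mul_inv_cancel,
        gamK_one, one_pow]
  have hfin : κ = -C.gamK x := by
    rw [gamK_inv] at hunit
    have := gamK_ne_zero x
    field_simp at hunit
    rw [← hunit, neg_neg]
  rw [hκ, hfin, hxK]
  refine LinearMap.ext fun v => ?_
  rw [LinearMap.smul_apply, LinearMap.neg_apply, LinearMap.smul_apply, neg_smul]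

end Main

end SymGCM

theorem mainTheorem10 {I : Type*} [Fintype I] [DecidableEq I] (C : SymGCM I)
    (hirr : C.Irreducible) (hfin : C.IsFiniteType) :
    C.Tw C.w₀ =
        -((C.q ^ (-((C.r : ℤ) * C.dualCoxeterNumber)) * C.t ^ C.coxeterNumber) • C.nu) ∧
      ∀ ω : List I, C.IsReducedWord ω C.w₀ →
        C.Tword ω =
          -((C.q ^ (-((C.r : ℤ) * C.dualCoxeterNumber)) * C.t ^ C.coxeterNumber) • C.nu) :=
  ⟨hfin.Tword_eq hirr (C.exists_reducedWord C.w₀).choose_spec, fun _ hω => hfin.Tword_eq hirr hω⟩
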